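/- Let $m$ nodes form a connected graph, and let $W=[w_{il}]\in\mathbb R^{m\times m}$ be a mixing matrix of it: $w_{il}>0$ if $i=l$ or $i,l$ are adjacent and $w_{il}=0$ otherwise, $W=W^\top$, $\mathrm{null}(I-W)=\mathrm{span}\{\mathbf 1\}$, $I\succeq W\succ -I$. Node $i$ holds functions $f_i^1,\dots,f_i^M:\mathbb R^n\to\mathbb R$; put $f_i=\frac1M\sum_{s=1}^M f_i^s$ and $f=\frac1m\sum_{i=1}^m f_i$. Assume that every $f_i$ is bounded below, and that all $f_i^s$ are differentiable with $\|\nabla f_i^s(x)\|\le B$ and $\|\nabla f_i^s(x)-\nabla f_i^s(y)\|\le L\|x-y\|$ for all $x,y$. Let $H$ be an irreducible, aperiodic stochastic $M\times M$ matrix whose stationary distribution is uniform on $\{1,\dots,M\}$. For every node $i$ let $(j_{i,k})_{k\ge0}$ be a time-homogeneous Markov chain with transition matrix $H$ (the Markov property holding relative to the samples and directions of all nodes up to the present time), and let $\mathbf h^{i,k}$ be uniform on the unit sphere of $\mathbb R^n$ and independent of all samples up to time $k$ and all directions before time $k$. Let $\gamma_k=(k+1)^{-\theta}$ with $\frac12<\theta<1$,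 and $\delta_k>0$ with $\sum_k\gamma_k\delta_k<\infty$. The zeroth-order DMGD iterates are $\mathbf x^0(i)=x^0$ and $$\mathbf x^{k+1}(i)=\sum_{l} w_{il}\,\mathbf x^k(l)-\gamma_k\,\frac{n\big(f_i^{j_{i,k}}(\mathbf x^k(i)+\delta_k\mathbf h^{i,k})-f_i^{j_{i,k}}(\mathbf x^k(i))\big)}{\delta_k}\,\mathbf h^{i,k},\qquad \overline{x^k}:=\frac1m\sum_{i=1}^m\mathbf x^k(i).$$ Let $\lambda_2(W)$ be the second largest absolute value of an eigenvalue of $W$ ($0$ if $m=1$), and let $\lambda(H)=\frac{\rho+1}{2}$, where $\rho$ is the second largest absolute value of a complex eigenvalue of $H$ ($0$ if $M=1$). Then $$\lim_{k\to\infty}\mathbb E\|\nabla f(\overline{x^k})\|=0,$$ and for all $k\ge1$ $$\min_{1\le i\le k}\mathbb E\|\nabla f(\overline{x^i})\|\le C\cdot\frac{\frac{1}{\ln(1/\lambda(H))}\cdot\frac{1}{1-\lambda_2(W)}+n^{3/2}}{k^{(1-\theta)/2}},$$ where $C$ depends only on $m$, $M$, $\theta$, $B$, $L$ and on upper bounds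 for $f(x^0)-\inf f$ and $\sum_k\gamma_k\delta_k$; in particular $C$ does not depend on $n$, $W$ or $H$. -/

import Mathlib

open MeasureTheory ProbabilityTheory Filter Topology
open scoped Gradient

noncomputable section

/-- `ℝⁿ` with its Euclidean norm. -/
abbrev Rn (n : ℕ) : Type := EuclideanSpace ℝ (Fin n)

/-- The unit sphere of `ℝⁿ`. -/
abbrev UnitSphere (n : ℕ) : Type := Metric.sphere (0 : Rn n) 1

/-- The uniform distribution on the unit sphere: normalized surface measure. -/
def sphereUniform (n : ℕ) : Measure (UnitSphere n) :=
  ProbabilityTheory.cond (volume : Measure (Rn n)).toSphere Set.univ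

/-! ### Matrices -/

/-- `W` is a mixing matrix of the graph `G` (the diagonal entries are positive as well). -/
structure IsMixingMatrix {m : ℕ} (G : SimpleGraph (Fin m)) (W : Matrix (Fin m) (Fin m) ℝ) :
    Prop where
  zero_of_not_adj : ∀ i l, i ≠ l → ¬ G.Adj i l → W i l = 0
  pos_of_adj : ∀ i l, (i = l ∨ G.Adj i l) → 0 < W i l
  symm : W.IsSymm
  null_space : LinearMap.ker (Matrix.toLin' (1 - W)) = Submodule.span ℝ {fun _ => (1 : ℝ)}
  le_one : (1 - W).PosSemidef
  neg_one_lt : (1 + W).PosDef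

/-- Irreducibility of a transition matrix. -/
def IsIrreducibleChain {M : ℕ} (H : Matrix (Fin M) (Fin M) ℝ) : Prop :=
  ∀ r s, ∃ k : ℕ, 0 < (H ^ k) r s

/-- Aperiodicity of a transition matrix: every state has period one, that is, `1` is the only
`d` that divides all the return times of the state. -/
def IsAperiodicChain {M : ℕ} (H : Matrix (Fin M) (Fin M) ℝ) : Prop :=
  ∀ r, ∀ d : ℕ, (∀ k : ℕ, 0 < (H ^ k) r r → d ∣ k) → d = 1

/-- A stochastic, irreducible, aperiodic transition matrix whose stationary distribution is the
uniform one. -/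
structure IsErgodicUniform {M : ℕ} (H : Matrix (Fin M) (Fin M) ℝ) : Prop where
  stochastic : H ∈ Matrix.rowStochastic ℝ (Fin M)
  irreducible : IsIrreducibleChain H
  aperiodic : IsAperiodicChain H
  stationary : Matrix.vecMul (fun _ => 1 / (M : ℝ)) H = fun _ => 1 / (M : ℝ)

/-- The largest absolute value of the (complex) eigenvalues of `A` other than `1`; it is `0` if
there are none. The eigenvalue `1` is simple for the matrices to which this is applied, and so
this is the second largest absolute value of an eigenvalue. -/
def secondModulus {N : ℕ} (A : Matrix (Fin N) (Fin N) ℝ) : ℝ :=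
  sSup ((fun z : ℂ => ‖z‖) '' (spectrum ℂ (A.map (algebraMap ℝ ℂ)) \ {1}))

/-- `λ(H)`: the mean of `1` and the second largest absolute value of an eigenvalue of `H`. -/
def lambdaH {M : ℕ} (H : Matrix (Fin M) (Fin M) ℝ) : ℝ := (secondModulus H + 1) / 2

/-! ### The objective -/

/-- The loss of node `i`, the average of its `M` sample losses. -/
def nodeLoss {n m M : ℕ} (f : Fin m → Fin M → Rn n → ℝ) (i : Fin m) (x : Rn n) : ℝ :=
  (1 / (M : ℝ)) * ∑ s, f i s x

/-- The objective, the average of the losses of the nodes. -/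
def objective {n m M : ℕ} (f : Fin m → Fin M → Rn n → ℝ) (x : Rn n) : ℝ :=
  (1 / (m : ℝ)) * ∑ i, nodeLoss f i x

/-- Every node loss is bounded below; the sample losses are differentiable, with gradients that
are bounded by `B` and Lipschitz continuous with constant `L`. -/
structure LossAssumptions {n m M : ℕ} (B L : ℝ) (f : Fin m → Fin M → Rn n → ℝ) : Prop where
  bddBelow : ∀ i, BddBelow (Set.range (nodeLoss f i))
  differentiable : ∀ i s, Differentiable ℝ (f i s)
  gradient_bound : ∀ i s x, ‖∇ (f i s) x‖ ≤ B
  gradient_lipschitz : ∀ i s x y, ‖∇ (f i s) x - ∇ (f i s) y‖ ≤ L * ‖x - y‖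

/-! ### The algorithm -/

/-- The two-point estimator `n (g (x + δ h) - g x) / δ · h` of the gradient of `g` at `x`. -/
def twoPoint {n : ℕ} (g : Rn n → ℝ) (δ : ℝ) (h x : Rn n) : Rn n :=
  ((n : ℝ) * (g (x + δ • h) - g x) / δ) • h

/-- The iterates `x^k(i)` of zeroth-order DMGD, started at `x⁰` in every node, along the samples
`j i k` and the directions `h i k`. As `W i l = 0` unless `l` is `i` or a neighbour of `i`, the
sum runs over all nodes. -/
def zoDMGD {n m M : ℕ} (W : Matrix (Fin m) (Fin m) ℝ) (f : Fin m → Fin M → Rn n → ℝ)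
    (γ δ : ℕ → ℝ) (x₀ : Rn n) (j : Fin m → ℕ → Fin M) (h : Fin m → ℕ → UnitSphere n) :
    ℕ → Fin m → Rn n
  | 0, _ => x₀
  | k + 1, i =>
      ∑ l, W i l • zoDMGD W f γ δ x₀ j h k l
        - γ k • twoPoint (f i (j i k)) (δ k) (h i k : Rn n) (zoDMGD W f γ δ x₀ j h k i)

/-- The average of the local variables. -/
def nodeAverage {n m : ℕ} (x : Fin m → Rn n) : Rn n := (1 / (m : ℝ)) • ∑ i, x i

/-! ### The random samples -/

/-- The information generated by all samples and directions up to and including time `k`. -/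
@[reducible] def history {Ω : Type*} {n m M : ℕ} (j : Fin m → ℕ → Ω → Fin M)
    (h : Fin m → ℕ → Ω → UnitSphere n) (k : ℕ) : MeasurableSpace Ω :=
  ⨆ (i : Fin m) (l : ℕ) (_ : l ≤ k),
    MeasurableSpace.comap (j i l) inferInstance ⊔ MeasurableSpace.comap (h i l) inferInstance

/-- The information available when the directions of time `k` are drawn: all samples up to and
including time `k`, and all directions before time `k`. -/
@[reducible] def preHistory {Ω : Type*} {n m M : ℕ} (j : Fin m → ℕ → Ω → Fin M)
    (h : Fin m → ℕ → Ω → UnitSphere n) (k : ℕ) : MeasurableSpace Ω :=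
  (⨆ (i : Fin m) (l : ℕ) (_ : l ≤ k), MeasurableSpace.comap (j i l) inferInstance) ⊔
    ⨆ (i : Fin m) (l : ℕ) (_ : l < k), MeasurableSpace.comap (h i l) inferInstance

/-- `X` is a time-homogeneous Markov chain with transition matrix `H` relative to the increasing
information `ℱ`: given `ℱ k`, the state at time `k + 1` has the distribution `H (X k) ·`. -/
def IsMarkovChain {Ω : Type*} [MeasurableSpace Ω] {M : ℕ} (P : Measure Ω)
    (ℱ : ℕ → MeasurableSpace Ω) (H : Matrix (Fin M) (Fin M) ℝ) (X : ℕ → Ω → Fin M) : Prop :=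
  ∀ (k : ℕ) (r s : Fin M) (A : Set Ω), MeasurableSet[ℱ k] A →
    P.real (A ∩ {ω | X k ω = r} ∩ {ω | X (k + 1) ω = s})
      = P.real (A ∩ {ω | X k ω = r}) * H r s

/-- The samples of every node form a Markov chain with transition matrix `H`; every direction is
uniform on the unit sphere, and it is drawn independently of what has happened before. -/
structure IsSampling {Ω : Type*} [MeasurableSpace Ω] {n m M : ℕ} (P : Measure Ω)
    (H : Matrix (Fin M) (Fin M) ℝ) (j : Fin m → ℕ → Ω → Fin M)
    (h : Fin m → ℕ → Ω → UnitSphere n) : Prop where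
  measurable_sample : ∀ i k, Measurable (j i k)
  measurable_direction : ∀ i k, Measurable (h i k)
  markov : ∀ i, IsMarkovChain P (history j h) H (j i)
  uniform : ∀ i k, P.map (h i k) = sphereUniform n
  indep : ∀ i k, Indep (MeasurableSpace.comap (h i k) inferInstance) (preHistory j h k) P

end

/-! ### Spectra of real matrices and the second modulus -/

section Matrices

open Matrix

/-! Write `y k` for the average of the nodes, `U k` for the gradient of the objective there and `ρ`
for the second modulus of `H`. Since `W` has unit column sums, mixing does not move the average, so
`y (k+1) = y k - γ k d k` with `d k` the mean of the two-point estimators. Taylor expansion of the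
objective along this path, summed over `k`, bounds `∑ γ k ⟪U k, d k⟫` by `D` plus multiples of `∑ γ
k ^ 2`, which is finite because `θ > 1/2`. It remains to compare `⟪U k, d k⟫` in expectation with
`‖U k‖ ^ 2`. Three errors separate them.

Directions: up to `O(n δ k)`, the estimator is `n ⟪g, h⟫ h` with `g` the sample gradient. The
direction is independent of `g` and `U k`, and `E (h hᵀ) = I / n`, so pairing with `U k` gives `E ⟪U
k, g⟫` (`integral_inner_direction`).

Consensus: `g` is evaluated at a local variable, not at `y k`. On vectors of zero mean `W` contracts
by its second modulus (`IsMixingMatrix.contraction`), so the weighted sum of the distances to the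
average costs `n / (1 - λ₂(W))` times `∑ γ k ^ 2`.

Sampling: the sample gradient is biased, because the chain is not stationary. The deviation is
centred under the uniform law, hence has the form `q - H q` with `q` a solution of the Poisson
equation. The Markov property turns its expectation into `E q (X k, Y k) - E q (X (k+1), Y k)`,
almost a telescoping difference, and Abel summation bounds the weighted sum
(`IsMarkovChain.abs_sum_integral_le`). The constant is the size of the fundamental matrix. As `H`
need not be normal, its spectrum alone does not control its powers uniformly; but `H` is doubly
stochastic, so the fundamental matrix is accretive, and an accretive matrix is bounded entrywise by
its spectral radius up to a factor depending on `M` (`abs_apply_le_of_accretive`). This gives `O(1 /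
(1 - ρ))` with no further dependence on `H`.

Altogether `∑ γ k E‖U k‖ ^ 2 ≤ C₀ T ^ 2`, with `T` the numerator of the rate. By Jensen the same
holds for the squares of `E‖U k‖`. Dividing by `∑ γ k`, of order at least `k ^ (1 - θ)`, gives the
rate; small increments of `E‖U k‖` together with the divergence of `∑ γ k` give the limit. -/

theorem exists_mulVec_eq_smul_of_mem_spectrum {K : Type*} [Field K] {N : ℕ}
    {A : Matrix (Fin N) (Fin N) K} {z : K} (hz : z ∈ spectrum K A) :
    ∃ v : Fin N → K, v ≠ 0 ∧ A *ᵥ v = z • v := by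
  rw [spectrum.mem_iff, Matrix.isUnit_iff_isUnit_det, isUnit_iff_ne_zero, not_not] at hz
  obtain ⟨v, hv, h⟩ := Matrix.exists_mulVec_eq_zero_iff.mpr hz
  refine ⟨v, hv, ?_⟩
  rw [Matrix.sub_mulVec, sub_eq_zero, Algebra.algebraMap_eq_smul_one, Matrix.smul_mulVec,
    Matrix.one_mulVec] at h
  exact h.symm

theorem mem_spectrum_of_mulVec_eq_smul {K : Type*} [Field K] {N : ℕ}
    {A : Matrix (Fin N) (Fin N) K} {z : K} {v : Fin N → K} (hv : v ≠ 0) (h : A *ᵥ v = z • v) :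
    z ∈ spectrum K A := by
  rw [spectrum.mem_iff, Matrix.isUnit_iff_isUnit_det, isUnit_iff_ne_zero, not_not]
  refine Matrix.exists_mulVec_eq_zero_iff.mp ⟨v, hv, ?_⟩
  rw [Matrix.sub_mulVec, sub_eq_zero, Algebra.algebraMap_eq_smul_one, Matrix.smul_mulVec,
    Matrix.one_mulVec, h]

theorem finite_norm_image_spectrum {N : ℕ} (A : Matrix (Fin N) (Fin N) ℝ) :
    ((fun z : ℂ => ‖z‖) '' (spectrum ℂ (A.map (algebraMap ℝ ℂ)) \ {1})).Finite :=
  ((Matrix.finite_spectrum _).subset Set.sdiff_subset).image _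

theorem norm_le_secondModulus {N : ℕ} {A : Matrix (Fin N) (Fin N) ℝ} {z : ℂ}
    (hz : z ∈ spectrum ℂ (A.map (algebraMap ℝ ℂ))) (h1 : z ≠ 1) : ‖z‖ ≤ secondModulus A :=
  le_csSup (finite_norm_image_spectrum A).bddAbove ⟨z, ⟨hz, h1⟩, rfl⟩

theorem secondModulus_nonneg {N : ℕ} (A : Matrix (Fin N) (Fin N) ℝ) : 0 ≤ secondModulus A := by
  refine Real.sSup_nonneg ?_
  rintro _ ⟨z, -, rfl⟩
  exact norm_nonneg z

/-- The spectrum is finite, so the supremum is attained and the strict inequality survives; over the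
empty set `sSup` is `0`. -/
theorem secondModulus_lt_one {N : ℕ} {A : Matrix (Fin N) (Fin N) ℝ}
    (h : ∀ z ∈ spectrum ℂ (A.map (algebraMap ℝ ℂ)), z ≠ 1 → ‖z‖ < 1) : secondModulus A < 1 := by
  rw [secondModulus]
  rcases Set.eq_empty_or_nonempty
    ((fun z : ℂ => ‖z‖) '' (spectrum ℂ (A.map (algebraMap ℝ ℂ)) \ {1})) with he | hne
  · rw [he, Real.sSup_empty]; exact one_pos
  · obtain ⟨z, ⟨hz, h1⟩, hzs⟩ := hne.csSup_mem (finite_norm_image_spectrum A)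
    rw [← hzs]
    exact h z hz h1

/-! ### Ergodic chains -/

theorem pow_mem_rowStochastic {M : ℕ} {H : Matrix (Fin M) (Fin M) ℝ}
    (hH : H ∈ Matrix.rowStochastic ℝ (Fin M)) (k : ℕ) : H ^ k ∈ Matrix.rowStochastic ℝ (Fin M) :=
  pow_mem hH k

/-- At a coordinate `r` where an eigenvector has maximal modulus, `z * v r` is a convex combination
of numbers of modulus at most `‖v r‖`. -/
theorem norm_le_one_of_mem_spectrum_rowStochastic {M : ℕ} {H : Matrix (Fin M) (Fin M) ℝ}
    (hH : H ∈ Matrix.rowStochastic ℝ (Fin M)) {z : ℂ}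
    (hz : z ∈ spectrum ℂ (H.map (algebraMap ℝ ℂ))) : ‖z‖ ≤ 1 := by
  obtain ⟨v, hv, h⟩ := exists_mulVec_eq_smul_of_mem_spectrum hz
  obtain ⟨s, hs⟩ := Function.ne_iff.mp hv
  have : Nonempty (Fin M) := ⟨s⟩
  obtain ⟨r, hr⟩ := Finite.exists_max (fun s => ‖v s‖)
  have hpos : 0 < ‖v r‖ := (norm_pos_iff.mpr hs).trans_le (hr s)
  have h2 : ‖z‖ * ‖v r‖ ≤ 1 * ‖v r‖ := by
    have := congrFun h r
    rw [Pi.smul_apply, smul_eq_mul] at this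
    rw [← norm_mul, ← this, ← Matrix.sum_row_of_mem_rowStochastic hH r, Finset.sum_mul,
      Matrix.mulVec, dotProduct]
    refine (norm_sum_le _ _).trans (Finset.sum_le_sum fun t _ => ?_)
    have h0 := Matrix.nonneg_of_mem_rowStochastic hH (i := r) (j := t)
    simp only [Matrix.map_apply, Complex.coe_algebraMap, norm_mul, Complex.norm_real,
      Real.norm_eq_abs, abs_of_nonneg h0]
    exact mul_le_mul_of_nonneg_left (hr t) h0
  exact le_of_mul_le_mul_right h2 hpos

/-- A convex combination of vectors of norm at most `‖w‖` equals `w` only if all the vectors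
that occur in it equal `w`. -/
theorem eq_of_convex_combination_eq {M : ℕ} {p : Fin M → ℝ} (hp : ∀ s, 0 ≤ p s)
    (hp1 : ∑ s, p s = 1) {v : Fin M → ℂ} {w : ℂ} (hv : ∀ s, ‖v s‖ ≤ ‖w‖)
    (hw : ∑ s, p s • v s = w) {s : Fin M} (hs : 0 < p s) : v s = w := by
  -- Strict convexity of the disc: the quantities `‖w‖ ^ 2 - ⟪w, v t⟫` are nonnegative and average
  -- to zero, so each one of positive weight vanishes.
  have key : ∑ t, p t * (‖w‖ ^ 2 - inner ℝ w (v t)) = 0 := by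
    have : inner ℝ w (∑ t, p t • v t) = ∑ t, p t * inner ℝ w (v t) := by
      rw [inner_sum]; exact Finset.sum_congr rfl fun t _ => real_inner_smul_right _ _ _
    simp only [mul_sub, Finset.sum_sub_distrib, ← Finset.sum_mul, hp1, ← this, hw]
    rw [real_inner_self_eq_norm_sq]; ring
  have hnn : ∀ t ∈ Finset.univ, 0 ≤ p t * (‖w‖ ^ 2 - inner ℝ w (v t)) := fun t _ => by
    refine mul_nonneg (hp t) ?_
    have h1 := real_inner_le_norm w (v t)
    nlinarith [hv t, norm_nonneg w]
  have h0 := (Finset.sum_eq_zero_iff_of_nonneg hnn).mp key s (Finset.mem_univ s)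
  have h1 : inner ℝ w (v s) = ‖w‖ ^ 2 := by
    rcases mul_eq_zero.mp h0 with h | h
    · exact absurd h hs.ne'
    · linarith
  have h2 : ‖w - v s‖ ^ 2 ≤ 0 := by
    rw [norm_sub_sq_real, h1]
    nlinarith [hv s, norm_nonneg (v s)]
  have h3 : ‖w - v s‖ = 0 := by nlinarith [norm_nonneg (w - v s)]
  exact (sub_eq_zero.mp (norm_eq_zero.mp h3)).symm

theorem map_pow_mulVec_eq {M : ℕ} {H : Matrix (Fin M) (Fin M) ℝ} {v : Fin M → ℂ} {z : ℂ}
    (h : H.map (algebraMap ℝ ℂ) *ᵥ v = z • v) (k : ℕ) :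
    (H ^ k).map (algebraMap ℝ ℂ) *ᵥ v = z ^ k • v := by
  induction k with
  | zero => simp [Matrix.map_one]
  | succ k ih =>
    rw [pow_succ, Matrix.map_mul, ← Matrix.mulVec_mulVec, h, Matrix.mulVec_smul, ih, smul_smul,
      pow_succ, mul_comm]

/-- An eigenvector for an eigenvalue on the unit circle propagates along the paths of the chain. -/
theorem eigenvector_propagates {M : ℕ} {H : Matrix (Fin M) (Fin M) ℝ}
    (hH : H ∈ Matrix.rowStochastic ℝ (Fin M)) {v : Fin M → ℂ} (hv : v ≠ 0) {z : ℂ}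
    (hz : ‖z‖ = 1) (h : H.map (algebraMap ℝ ℂ) *ᵥ v = z • v) :
    ∃ r, v r ≠ 0 ∧ ∀ k s, 0 < (H ^ k) r s → v s = z ^ k * v r := by
  obtain ⟨s, hs⟩ := Function.ne_iff.mp hv
  have : Nonempty (Fin M) := ⟨s⟩
  obtain ⟨r, hr⟩ := Finite.exists_max (fun s => ‖v s‖)
  -- With `r` of maximal modulus and `‖z‖ = 1`, the value `z ^ k * v r` is a convex combination,
  -- with weights `(H ^ k) r ·`, of numbers no larger in modulus: the equality case above.
  have hpos : 0 < ‖v r‖ := (norm_pos_iff.mpr hs).trans_le (hr s)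
  refine ⟨r, norm_pos_iff.mp hpos, fun k s hks => ?_⟩
  have hk := pow_mem_rowStochastic hH k
  refine eq_of_convex_combination_eq (p := fun t => (H ^ k) r t)
    (fun t => Matrix.nonneg_of_mem_rowStochastic hk) (Matrix.sum_row_of_mem_rowStochastic hk r)
    (fun t => ?_) ?_ hks
  · rw [norm_mul, norm_pow, hz, one_pow, one_mul]; exact hr t
  · have := congrFun (map_pow_mulVec_eq h k) r
    rw [Pi.smul_apply, smul_eq_mul] at this
    rw [← this]
    simp [Matrix.mulVec, dotProduct]

/-- Propagation from `r` back to `r` gives `z ^ k = 1` for each return time `k`, so the order of `z`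
divides all return times and aperiodicity makes it `1`. -/
theorem eigenvalue_eq_one_of_norm_eq_one {M : ℕ} {H : Matrix (Fin M) (Fin M) ℝ}
    (hH : IsErgodicUniform H) {v : Fin M → ℂ} (hv : v ≠ 0) {z : ℂ}
    (hz : ‖z‖ = 1) (h : H.map (algebraMap ℝ ℂ) *ᵥ v = z • v) : z = 1 := by
  obtain ⟨r, hr, hp⟩ := eigenvector_propagates hH.stochastic hv hz h
  rw [← orderOf_eq_one_iff]
  refine hH.aperiodic r _ fun k hk => orderOf_dvd_of_pow_eq_one ?_
  have := hp k r hk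
  exact mul_right_cancel₀ hr (by rw [one_mul]; exact this.symm)

theorem harmonic_const {M : ℕ} {H : Matrix (Fin M) (Fin M) ℝ}
    (hH : IsErgodicUniform H) {v : Fin M → ℂ} (h : H.map (algebraMap ℝ ℂ) *ᵥ v = v)
    (r s : Fin M) : v r = v s := by
  by_cases hv : v = 0
  · simp [hv]
  obtain ⟨t, -, hp⟩ := eigenvector_propagates hH.stochastic hv (z := 1) norm_one (by simpa using h)
  have key : ∀ s, v s = v t := fun s => by
    obtain ⟨k, hk⟩ := hH.irreducible t s
    simpa using hp k s hk
  rw [key r, key s]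

theorem IsErgodicUniform.secondModulus_lt_one {M : ℕ} {H : Matrix (Fin M) (Fin M) ℝ}
    (hH : IsErgodicUniform H) : secondModulus H < 1 := by
  refine _root_.secondModulus_lt_one fun z hz h1 => ?_
  refine lt_of_le_of_ne (norm_le_one_of_mem_spectrum_rowStochastic hH.stochastic hz) fun h => h1 ?_
  obtain ⟨v, hv, hvz⟩ := exists_mulVec_eq_smul_of_mem_spectrum hz
  exact eigenvalue_eq_one_of_norm_eq_one hH hv h hvz

/-- Uniform stationarity makes `H` doubly stochastic; the accretivity of the fundamental matrix
rests on this. -/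
theorem IsErgodicUniform.sum_col {M : ℕ} {H : Matrix (Fin M) (Fin M) ℝ}
    (hH : IsErgodicUniform H) (s : Fin M) : ∑ r, H r s = 1 := by
  have hM : (M : ℝ) ≠ 0 := by
    have := s.pos
    positivity
  have h := congrFun hH.stationary s
  simp only [Matrix.vecMul, dotProduct, ← Finset.mul_sum] at h
  field_simp at h
  exact h

/-! ### The fundamental matrix of an ergodic chain -/

/-- `1 - H + Π`, where `Π` is the projection onto the constants. -/
noncomputable def regularizedLaplacian {M : ℕ} (H : Matrix (Fin M) (Fin M) ℝ) : Matrix (Fin M) (Fin M) ℝ :=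
  1 - H + Matrix.of fun _ _ => 1 / (M : ℝ)

theorem regularizedLaplacian_mulVec {M : ℕ} (H : Matrix (Fin M) (Fin M) ℝ) (v : Fin M → ℝ)
    (r : Fin M) :
    (regularizedLaplacian H *ᵥ v) r = v r - (H *ᵥ v) r + (1 / (M : ℝ)) * ∑ s, v s := by
  rw [regularizedLaplacian, Matrix.add_mulVec, Matrix.sub_mulVec, Matrix.one_mulVec, Pi.add_apply,
    Pi.sub_apply, Finset.mul_sum]
  rfl

theorem regularizedLaplacian_map_mulVec {M : ℕ} (H : Matrix (Fin M) (Fin M) ℝ) (v : Fin M → ℂ)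
    (r : Fin M) :
    ((regularizedLaplacian H).map (algebraMap ℝ ℂ) *ᵥ v) r
      = v r - (H.map (algebraMap ℝ ℂ) *ᵥ v) r + (1 / (M : ℂ)) * ∑ s, v s := by
  have : (regularizedLaplacian H).map (algebraMap ℝ ℂ)
      = 1 - H.map (algebraMap ℝ ℂ) + Matrix.of fun _ _ => 1 / (M : ℂ) := by
    ext i j
    by_cases hij : i = j <;> simp [regularizedLaplacian, hij]
  rw [this, Matrix.add_mulVec, Matrix.sub_mulVec, Matrix.one_mulVec, Pi.add_apply,
    Pi.sub_apply, Finset.mul_sum]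
  rfl

theorem IsErgodicUniform.sum_map_mulVec {M : ℕ} {H : Matrix (Fin M) (Fin M) ℝ}
    (hH : IsErgodicUniform H) (v : Fin M → ℂ) :
    ∑ r, (H.map (algebraMap ℝ ℂ) *ᵥ v) r = ∑ s, v s := by
  simp only [Matrix.mulVec, dotProduct]
  rw [Finset.sum_comm]
  refine Finset.sum_congr rfl fun s _ => ?_
  rw [← Finset.sum_mul]
  have : ∑ r, (H.map (algebraMap ℝ ℂ)) r s = 1 := by
    have := hH.sum_col s
    simp only [Matrix.map_apply, Complex.coe_algebraMap]
    exact_mod_cast this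
  rw [this, one_mul]

theorem IsErgodicUniform.sum_mulVec {M : ℕ} {H : Matrix (Fin M) (Fin M) ℝ}
    (hH : IsErgodicUniform H) (v : Fin M → ℝ) : ∑ r, (H *ᵥ v) r = ∑ s, v s := by
  simp only [Matrix.mulVec, dotProduct]
  rw [Finset.sum_comm]
  refine Finset.sum_congr rfl fun s _ => ?_
  rw [← Finset.sum_mul, hH.sum_col, one_mul]

/-- An eigenvector of `1 - H + Π` for an eigenvalue other than `1` has zero
mean and is an eigenvector of `H`. -/
theorem IsErgodicUniform.eigen_regularizedLaplacian {M : ℕ} {H : Matrix (Fin M) (Fin M) ℝ}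
    (hH : IsErgodicUniform H) {v : Fin M → ℂ} {y : ℂ}
    (h : (regularizedLaplacian H).map (algebraMap ℝ ℂ) *ᵥ v = y • v) (hy : y ≠ 1) :
    ∑ s, v s = 0 ∧ H.map (algebraMap ℝ ℂ) *ᵥ v = (1 - y) • v := by
  have hsum : ∑ s, v s = 0 := by
    rcases Nat.eq_zero_or_pos M with rfl | hM
    · simp
    have hM' : (M : ℂ) ≠ 0 := by exact_mod_cast hM.ne'
    have := congrArg (fun u : Fin M → ℂ => ∑ r, u r) h
    simp only [regularizedLaplacian_map_mulVec, Finset.sum_add_distrib, Finset.sum_sub_distrib,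
      hH.sum_map_mulVec, Finset.sum_const, Finset.card_univ, Fintype.card_fin, nsmul_eq_mul,
      Pi.smul_apply, smul_eq_mul, ← Finset.mul_sum] at this
    have h2 : (y - 1) * ∑ s, v s = 0 := by
      field_simp at this
      linear_combination -this
    exact (mul_eq_zero.mp h2).resolve_left (sub_ne_zero.mpr hy)
  refine ⟨hsum, funext fun r => ?_⟩
  have := congrFun h r
  rw [regularizedLaplacian_map_mulVec, hsum] at this
  simp only [Pi.smul_apply, smul_eq_mul] at this ⊢
  linear_combination -this

/-- A kernel vector has zero mean and is harmonic for `H`; harmonic vectors are constant, so it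
vanishes. -/
theorem IsErgodicUniform.det_regularizedLaplacian_ne_zero {M : ℕ} {H : Matrix (Fin M) (Fin M) ℝ}
    (hH : IsErgodicUniform H) : ((regularizedLaplacian H).map (algebraMap ℝ ℂ)).det ≠ 0 := by
  intro h0
  obtain ⟨v, hv, h⟩ := Matrix.exists_mulVec_eq_zero_iff.mpr h0
  obtain ⟨hs, h1⟩ := hH.eigen_regularizedLaplacian (v := v) (y := 0) (by simpa using h) zero_ne_one
  refine hv (funext fun r => ?_)
  have hc : ∀ s, v s = v r := fun s => harmonic_const hH (by simpa using h1) s r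
  rw [Finset.sum_congr rfl fun s _ => hc s] at hs
  have := r.pos
  simpa [this.ne'] using hs

theorem IsErgodicUniform.isUnit_regularizedLaplacian {M : ℕ} {H : Matrix (Fin M) (Fin M) ℝ}
    (hH : IsErgodicUniform H) : IsUnit (regularizedLaplacian H).det := by
  rw [isUnit_iff_ne_zero]
  intro h
  refine hH.det_regularizedLaplacian_ne_zero ?_
  have := RingHom.map_det (algebraMap ℝ ℂ) (regularizedLaplacian H)
  rw [h, map_zero] at this
  exact this.symm

/-- The fundamental matrix of a chain with uniform stationary distribution. -/
noncomputable def fundamentalMatrix {M : ℕ} (H : Matrix (Fin M) (Fin M) ℝ) : Matrix (Fin M) (Fin M) ℝ :=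
  (regularizedLaplacian H)⁻¹

/-- An eigenvalue `z ≠ 1` of the inverse makes `1 - z⁻¹` an eigenvalue of `H` other than `1`. So `‖1
- z⁻¹‖` is at most the second modulus, which keeps `z⁻¹` away from zero. -/
theorem IsErgodicUniform.norm_le_of_mem_spectrum_fundamentalMatrix {M : ℕ}
    {H : Matrix (Fin M) (Fin M) ℝ} (hH : IsErgodicUniform H) {z : ℂ}
    (hz : z ∈ spectrum ℂ ((fundamentalMatrix H).map (algebraMap ℝ ℂ))) :
    ‖z‖ ≤ 1 / (1 - secondModulus H) := by
  have hρ := hH.secondModulus_lt_one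
  have hρ0 := secondModulus_nonneg H
  obtain ⟨v, hv, h⟩ := exists_mulVec_eq_smul_of_mem_spectrum hz
  have hAZ : (regularizedLaplacian H).map (algebraMap ℝ ℂ)
      * (fundamentalMatrix H).map (algebraMap ℝ ℂ) = 1 := by
    rw [← Matrix.map_mul, fundamentalMatrix, Matrix.mul_nonsing_inv _ hH.isUnit_regularizedLaplacian]
    simp [Matrix.map_one]
  have h1 : v = z • (regularizedLaplacian H).map (algebraMap ℝ ℂ) *ᵥ v := by
    rw [← Matrix.mulVec_smul, ← h, Matrix.mulVec_mulVec, hAZ, Matrix.one_mulVec]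
  have hz0 : z ≠ 0 := by
    rintro rfl
    exact hv (by simpa using h1)
  have h2 : (regularizedLaplacian H).map (algebraMap ℝ ℂ) *ᵥ v = z⁻¹ • v := by
    conv_rhs => rw [h1]
    rw [smul_smul, inv_mul_cancel₀ hz0, one_smul]
  by_cases hz1 : z = 1
  · rw [hz1, norm_one, le_div_iff₀ (by linarith)]
    linarith
  obtain ⟨-, h3⟩ := hH.eigen_regularizedLaplacian h2 (by simpa using hz1)
  have h4 := norm_le_secondModulus (mem_spectrum_of_mulVec_eq_smul hv h3)
    (by simpa using hz0)
  have h5 : 1 - ‖z⁻¹‖ ≤ ‖1 - z⁻¹‖ := by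
    simpa using norm_sub_norm_le (1 : ℂ) z⁻¹
  have h6 : 1 - secondModulus H ≤ ‖z‖⁻¹ := by rw [← norm_inv]; linarith
  rw [one_div]
  exact (le_inv_comm₀ (by linarith) (norm_pos_iff.mpr hz0)).mp h6

/-- The trace is the sum of the `M` roots of the characteristic polynomial, counted with
multiplicity. -/
theorem norm_trace_le_of_spectrum {M : ℕ} {A : Matrix (Fin M) (Fin M) ℂ} {R : ℝ}
    (h : ∀ z ∈ spectrum ℂ A, ‖z‖ ≤ R) : ‖A.trace‖ ≤ M * R := by
  rw [Matrix.trace_eq_sum_roots_charpoly]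
  have h1 : ‖A.charpoly.roots.sum‖ ≤ (A.charpoly.roots.map fun z => ‖z‖).sum :=
    norm_multiset_sum_le _
  have h2 : (A.charpoly.roots.map fun z => ‖z‖).sum
      ≤ Multiset.card (A.charpoly.roots.map fun z => ‖z‖) • R := by
    refine Multiset.sum_le_card_nsmul _ _ fun x hx => ?_
    obtain ⟨z, hz, rfl⟩ := Multiset.mem_map.mp hx
    exact h z (Matrix.mem_spectrum_of_isRoot_charpoly (Polynomial.isRoot_of_mem_roots hz))
  have h3 : Multiset.card A.charpoly.roots = M := by
    rw [← (IsAlgClosed.splits A.charpoly).natDegree_eq_card_roots, Matrix.charpoly_natDegree_eq_dim,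
      Fintype.card_fin]
  rw [Multiset.card_map, h3, nsmul_eq_mul] at h2
  exact h1.trans h2

theorem trace_map_algebraMap {M : ℕ} (A : Matrix (Fin M) (Fin M) ℝ) :
    (A.map (algebraMap ℝ ℂ)).trace = (A.trace : ℂ) := by
  simp [Matrix.trace]

/-- A real matrix `Z` with `⟪Z v, v⟫ ≥ 0` is controlled by its spectrum. -/
theorem abs_apply_le_of_accretive {M : ℕ} {Z : Matrix (Fin M) (Fin M) ℝ} {R : ℝ}
    (hR : ∀ z ∈ spectrum ℂ (Z.map (algebraMap ℝ ℂ)), ‖z‖ ≤ R) (hR0 : 0 ≤ R)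
    (hZ : ∀ v : Fin M → ℝ, 0 ≤ v ⬝ᵥ Z *ᵥ v) (r s : Fin M) :
    |Z r s| ≤ (2 * (M : ℝ) ^ 2 + 2) * R := by
  have htr : Z.trace ≤ M * R := by
    have h := norm_trace_le_of_spectrum hR
    rw [trace_map_algebraMap, Complex.norm_real] at h
    exact (le_abs_self _).trans h
  have htr2 : -(Z * Z).trace ≤ M * R ^ 2 := by
    have h : ‖(Z.map (algebraMap ℝ ℂ) * Z.map (algebraMap ℝ ℂ)).trace‖ ≤ M * R ^ 2 := by
      refine norm_trace_le_of_spectrum fun z hz => ?_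
      rw [← pow_two, spectrum.map_pow_of_pos _ (by norm_num : 0 < 2)] at hz
      obtain ⟨y, hy, rfl⟩ := hz
      simp only [norm_pow]
      exact pow_le_pow_left₀ (norm_nonneg _) (hR y hy) 2
    rw [← Matrix.map_mul, trace_map_algebraMap, Complex.norm_real] at h
    exact (neg_le_abs _).trans h
  have hdiag : ∀ i, 0 ≤ Z i i := fun i => by
    simpa [Matrix.mulVec_single] using hZ (Pi.single i 1)
  have hdt : ∀ i, Z i i ≤ M * R := fun i =>
    (Finset.single_le_sum (f := fun i => Z i i) (fun i _ => hdiag i) (Finset.mem_univ i)).trans htr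
  -- Accretivity tested on `e_i ± e_j` bounds the off-diagonal entries of the symmetric part by the
  -- diagonal ones, hence by the trace.
  have hsym : ∀ i j, (Z i j + Z j i) ^ 2 ≤ (2 * (M * R)) ^ 2 := fun i j => by
    have h1 := hZ (Pi.single i 1 + Pi.single j 1)
    have h2 := hZ (Pi.single i 1 - Pi.single j 1)
    simp [Matrix.mulVec_single, Matrix.mulVec_add, Matrix.mulVec_sub] at h1 h2
    rw [sq_le_sq, abs_of_nonneg (by positivity : 0 ≤ 2 * ((M : ℝ) * R)), abs_le]
    have := hdt i
    have := hdt j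
    constructor <;> linarith
  have htrsum : (Z * Z).trace = ∑ i, ∑ j, Z i j * Z j i := by
    simp [Matrix.trace, Matrix.mul_apply]
  -- The skew part is reached through `tr (Z ^ 2)`: the Frobenius norms of the skew and symmetric
  -- parts differ by a multiple of it, and the spectrum bounds it.
  have hskew : (Z r s - Z s r) ^ 2 ≤ (M * (M * (2 * (M * R)) ^ 2)) + 4 * (M * R ^ 2) := by
    calc (Z r s - Z s r) ^ 2 ≤ ∑ j, (Z r j - Z j r) ^ 2 :=
          Finset.single_le_sum (f := fun j => (Z r j - Z j r) ^ 2) (fun _ _ => sq_nonneg _)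
            (Finset.mem_univ s)
      _ ≤ ∑ i, ∑ j, (Z i j - Z j i) ^ 2 :=
          Finset.single_le_sum (f := fun i => ∑ j, (Z i j - Z j i) ^ 2)
            (fun _ _ => Finset.sum_nonneg fun _ _ => sq_nonneg _) (Finset.mem_univ r)
      _ = ∑ i, ∑ j, (Z i j + Z j i) ^ 2 - 4 * (Z * Z).trace := by
          rw [htrsum, Finset.mul_sum, ← Finset.sum_sub_distrib]
          refine Finset.sum_congr rfl fun i _ => ?_
          rw [Finset.mul_sum, ← Finset.sum_sub_distrib]
          exact Finset.sum_congr rfl fun j _ => by ring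
      _ ≤ ∑ _i : Fin M, ∑ _j : Fin M, (2 * (M * R)) ^ 2 + 4 * (M * R ^ 2) := by
          have := Finset.sum_le_sum fun i (_ : i ∈ Finset.univ) =>
            Finset.sum_le_sum fun j (_ : j ∈ Finset.univ) => hsym i j
          linarith
      _ = _ := by simp
  refine abs_le_of_sq_le_sq ?_ (by positivity)
  have hM : 0 ≤ (M : ℝ) := by positivity
  have h1 : (2 * Z r s) ^ 2 ≤ 2 * ((Z r s + Z s r) ^ 2 + (Z r s - Z s r) ^ 2) := by
    nlinarith [sq_nonneg ((Z r s + Z s r) - (Z r s - Z s r))]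
  have h2 := hsym r s
  -- This is `((2M² + 2)² - 2(M⁴ + M² + M)) R²`, the slack in the final estimate, written as a sum
  -- of visibly nonnegative terms.
  have h3 : 0 ≤ (2 * (M : ℝ) ^ 4 + 5 * M ^ 2 + 3 + (M - 1) ^ 2) * R ^ 2 := by positivity
  nlinarith

/-- With `u = (1 - H + Π) v`, accretivity says `∑ v² - ∑ H a b v a v b + (∑ v)² / M ≥ 0`. The middle
sum is at most `∑ v²` by `2 v a v b ≤ v a² + v b²` and double stochasticity. -/
theorem IsErgodicUniform.abs_fundamentalMatrix_le {M : ℕ} {H : Matrix (Fin M) (Fin M) ℝ}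
    (hH : IsErgodicUniform H) (r s : Fin M) :
    |fundamentalMatrix H r s| ≤ (2 * (M : ℝ) ^ 2 + 2) * (1 / (1 - secondModulus H)) := by
  have hρ := hH.secondModulus_lt_one
  refine abs_apply_le_of_accretive
    (fun z hz => hH.norm_le_of_mem_spectrum_fundamentalMatrix hz)
    (one_div_nonneg.mpr (by linarith)) (fun u => ?_) r s
  have hu : u = regularizedLaplacian H *ᵥ (fundamentalMatrix H *ᵥ u) := by
    rw [Matrix.mulVec_mulVec, fundamentalMatrix,
      Matrix.mul_nonsing_inv _ hH.isUnit_regularizedLaplacian, Matrix.one_mulVec]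
  generalize fundamentalMatrix H *ᵥ u = v at hu
  have h1 : u ⬝ᵥ v = ∑ a, v a * v a - ∑ a, ∑ b, H a b * (v a * v b)
      + (1 / (M : ℝ)) * (∑ a, v a) ^ 2 := by
    have e1 : ∀ a, u a = v a - (H *ᵥ v) a + (1 / (M : ℝ)) * ∑ s, v s := fun a => by
      rw [hu, regularizedLaplacian_mulVec]
    simp only [dotProduct, e1, add_mul, sub_mul, Finset.sum_add_distrib,
      Finset.sum_sub_distrib, ← Finset.mul_sum]
    congr 1
    · congr 1
      refine Finset.sum_congr rfl fun a _ => ?_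
      rw [Matrix.mulVec, dotProduct, Finset.sum_mul]
      exact Finset.sum_congr rfl fun b _ => by ring
    · rw [mul_assoc, ← pow_two]
  have h2 : ∑ a, ∑ b, H a b * (v a * v b) ≤ ∑ a, ∑ b, H a b * ((v a * v a + v b * v b) / 2) :=
    Finset.sum_le_sum fun a _ => Finset.sum_le_sum fun b _ =>
      mul_le_mul_of_nonneg_left (by nlinarith [sq_nonneg (v a - v b)])
        (Matrix.nonneg_of_mem_rowStochastic hH.stochastic)
  have h3 : ∑ a, ∑ b, H a b * ((v a * v a + v b * v b) / 2) = ∑ a, v a * v a := by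
    have e1 : ∑ a, ∑ b, H a b * (v a * v a) = ∑ a, v a * v a :=
      Finset.sum_congr rfl fun a _ => by
        rw [← Finset.sum_mul, Matrix.sum_row_of_mem_rowStochastic hH.stochastic, one_mul]
    have e2 : ∑ a, ∑ b, H a b * (v b * v b) = ∑ a, v a * v a := by
      rw [Finset.sum_comm]
      exact Finset.sum_congr rfl fun a _ => by
        rw [← Finset.sum_mul, hH.sum_col, one_mul]
    have : ∑ a, ∑ b, H a b * ((v a * v a + v b * v b) / 2)
        = (∑ a, ∑ b, H a b * (v a * v a) + ∑ a, ∑ b, H a b * (v b * v b)) / 2 := by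
      rw [← Finset.sum_add_distrib, Finset.sum_div]
      refine Finset.sum_congr rfl fun a _ => ?_
      rw [← Finset.sum_add_distrib, Finset.sum_div]
      exact Finset.sum_congr rfl fun b _ => by ring
    rw [this, e1, e2]; ring
  rw [h1]
  have : 0 ≤ (1 / (M : ℝ)) * (∑ a, v a) ^ 2 := by positivity
  linarith

/-- The fundamental matrix solves the Poisson equation. -/
theorem IsErgodicUniform.poisson {M : ℕ} {H : Matrix (Fin M) (Fin M) ℝ}
    (hH : IsErgodicUniform H) {u : Fin M → ℝ} (hu : ∑ s, u s = 0) (r : Fin M) :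
    (fundamentalMatrix H *ᵥ u) r - (H *ᵥ (fundamentalMatrix H *ᵥ u)) r = u r := by
  have h : regularizedLaplacian H *ᵥ (fundamentalMatrix H *ᵥ u) = u := by
    rw [Matrix.mulVec_mulVec, fundamentalMatrix,
      Matrix.mul_nonsing_inv _ hH.isUnit_regularizedLaplacian, Matrix.one_mulVec]
  generalize fundamentalMatrix H *ᵥ u = v at h
  -- Summing the equation over all states cancels `v - H v` and leaves `∑ v = ∑ u = 0`, so the
  -- projection term drops out.
  have hs : ∑ s, v s = 0 := by
    have hM : (M : ℝ) ≠ 0 := by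
      have := r.pos
      positivity
    rw [← h] at hu
    simp only [regularizedLaplacian_mulVec, Finset.sum_add_distrib, Finset.sum_sub_distrib,
      hH.sum_mulVec, Finset.sum_const, Finset.card_univ, Fintype.card_fin, nsmul_eq_mul] at hu
    field_simp at hu
    linarith
  have := congrFun h r
  rw [regularizedLaplacian_mulVec, hs] at this
  linarith

/-! ### Mixing matrices -/

/-- By symmetry the spectrum is real, and the quadratic forms of `1 - W` and `1 + W` at an
eigenvector place it in `(-1, 1]`. -/
theorem IsMixingMatrix.secondModulus_lt_one {m : ℕ} {G : SimpleGraph (Fin m)}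
    {W : Matrix (Fin m) (Fin m) ℝ} (hW : IsMixingMatrix G W) : secondModulus W < 1 := by
  refine _root_.secondModulus_lt_one fun z hz h1 => ?_
  have hc : (W.map (algebraMap ℝ ℂ)).IsHermitian := by
    ext i j
    simp [hW.symm.apply i j]
  obtain ⟨y, rfl⟩ : ∃ y : ℝ, (y : ℂ) = z := by
    rw [hc.spectrum_eq_image_range] at hz
    obtain ⟨y, -, hy⟩ := hz
    exact ⟨y, hy⟩
  have hy : y ∈ spectrum ℝ W := by
    rw [Matrix.mem_spectrum_iff_isRoot_charpoly] at hz ⊢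
    rw [Matrix.charpoly_map] at hz
    exact (Polynomial.isRoot_map_iff (algebraMap ℝ ℂ).injective).mp hz
  obtain ⟨v, hv, h⟩ := exists_mulVec_eq_smul_of_mem_spectrum hy
  have hvv : 0 < v ⬝ᵥ v := by
    rw [← star_trivial v]
    exact Matrix.dotProduct_star_self_pos_iff.mpr (by simpa using hv)
  have hle := hW.le_one.dotProduct_mulVec_nonneg v
  have hlt := hW.neg_one_lt.dotProduct_mulVec_pos hv
  rw [star_trivial, Matrix.sub_mulVec, Matrix.one_mulVec, h, dotProduct_sub, dotProduct_smul,
    smul_eq_mul] at hle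
  rw [star_trivial, Matrix.add_mulVec, Matrix.one_mulVec, h, dotProduct_add, dotProduct_smul,
    smul_eq_mul] at hlt
  have hne : y ≠ 1 := fun hh => h1 (by rw [hh]; norm_num)
  have h2 : y ≤ 1 := by nlinarith
  have h3 : -1 < y := by nlinarith
  rw [Complex.norm_real, Real.norm_eq_abs, abs_lt]
  exact ⟨h3, lt_of_le_of_ne h2 hne⟩

theorem IsMixingMatrix.sum_row {m : ℕ} {G : SimpleGraph (Fin m)}
    {W : Matrix (Fin m) (Fin m) ℝ} (hW : IsMixingMatrix G W) (i : Fin m) : ∑ l, W i l = 1 := by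
  have h : (fun _ => (1 : ℝ)) ∈ LinearMap.ker (Matrix.toLin' (1 - W)) := by
    rw [hW.null_space]; exact Submodule.mem_span_singleton_self _
  rw [LinearMap.mem_ker, Matrix.toLin'_apply, Matrix.sub_mulVec, Matrix.one_mulVec] at h
  have := congrFun h i
  simp only [Pi.sub_apply, Matrix.mulVec, dotProduct, mul_one, Pi.zero_apply] at this
  linarith

theorem IsMixingMatrix.sum_col {m : ℕ} {G : SimpleGraph (Fin m)}
    {W : Matrix (Fin m) (Fin m) ℝ} (hW : IsMixingMatrix G W) (l : Fin m) : ∑ i, W i l = 1 := by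
  rw [← hW.sum_row l]
  exact Finset.sum_congr rfl fun i _ => hW.symm.apply l i

theorem IsMixingMatrix.sum_mulVec {m : ℕ} {G : SimpleGraph (Fin m)}
    {W : Matrix (Fin m) (Fin m) ℝ} (hW : IsMixingMatrix G W) (v : Fin m → ℝ) :
    ∑ i, (W *ᵥ v) i = ∑ i, v i := by
  simp only [Matrix.mulVec, dotProduct]
  rw [Finset.sum_comm]
  refine Finset.sum_congr rfl fun s _ => ?_
  rw [← Finset.sum_mul, hW.sum_col, one_mul]

/-- `W` contracts the vectors of zero mean by the factor `λ₂(W)`. -/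
theorem IsMixingMatrix.contraction {m : ℕ} {G : SimpleGraph (Fin m)}
    {W : Matrix (Fin m) (Fin m) ℝ} (hW : IsMixingMatrix G W) {v : Fin m → ℝ} (hv : ∑ i, v i = 0) :
    ∑ i, (W *ᵥ v) i ^ 2 ≤ secondModulus W ^ 2 * ∑ i, v i ^ 2 := by
  -- Removing the projection onto the constants leaves `W` unchanged on vectors of zero mean. A
  -- nonzero eigenvalue of the symmetric matrix `A` has a zero-mean eigenvector, so it is an
  -- eigenvalue of `W` other than `1`; diagonalizing `A` then gives the contraction.
  set A : Matrix (Fin m) (Fin m) ℝ := W - Matrix.of fun _ _ => 1 / (m : ℝ) with hA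
  have hAv : ∀ u : Fin m → ℝ, ∀ i, (A *ᵥ u) i = (W *ᵥ u) i - (1 / (m : ℝ)) * ∑ s, u s := by
    intro u i
    rw [hA, Matrix.sub_mulVec, Pi.sub_apply, Finset.mul_sum]
    rfl
  have hAh : A.IsHermitian := by
    ext i j
    simp [hA, hW.symm.apply i j]
  have hev : ∀ i, |hAh.eigenvalues i| ≤ secondModulus W := by
    intro i
    set y := hAh.eigenvalues i
    have hb : A *ᵥ ⇑(hAh.eigenvectorBasis i) = y • ⇑(hAh.eigenvectorBasis i) :=
      hAh.mulVec_eigenvectorBasis i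
    have hb0 : (⇑(hAh.eigenvectorBasis i) : Fin m → ℝ) ≠ 0 := by
      intro h0
      have := hAh.eigenvectorBasis.orthonormal.ne_zero i
      exact this (by ext l; exact congrFun h0 l)
    generalize (⇑(hAh.eigenvectorBasis i) : Fin m → ℝ) = b at hb hb0
    have hm : (m : ℝ) ≠ 0 := by
      have := i.pos
      positivity
    by_cases hy : y = 0
    · rw [hy, abs_zero]; exact secondModulus_nonneg W
    have hs : ∑ l, b l = 0 := by
      have := congrArg (fun u : Fin m → ℝ => ∑ l, u l) hb
      simp only [hAv, Finset.sum_sub_distrib, hW.sum_mulVec, Finset.sum_const, Finset.card_univ,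
        Fintype.card_fin, nsmul_eq_mul, Pi.smul_apply, smul_eq_mul, ← Finset.mul_sum] at this
      have h2 : y * ∑ l, b l = 0 := by
        rw [← this]
        field_simp
        ring
      exact (mul_eq_zero.mp h2).resolve_left hy
    have hWb : W *ᵥ b = y • b := by
      funext l
      have := congrFun hb l
      rw [hAv, hs] at this
      linarith
    have hy1 : y ≠ 1 := by
      intro h1
      have hk : b ∈ LinearMap.ker (Matrix.toLin' (1 - W)) := by
        rw [LinearMap.mem_ker, Matrix.toLin'_apply, Matrix.sub_mulVec, Matrix.one_mulVec, hWb, h1,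
          one_smul, sub_self]
      rw [hW.null_space, Submodule.mem_span_singleton] at hk
      obtain ⟨a, rfl⟩ := hk
      apply hb0
      simp [hm] at hs
      simp [hs]
    have hz : (y : ℂ) ∈ spectrum ℂ (W.map (algebraMap ℝ ℂ)) := by
      have := mem_spectrum_of_mulVec_eq_smul hb0 hWb
      rw [Matrix.mem_spectrum_iff_isRoot_charpoly] at this ⊢
      rw [Matrix.charpoly_map]
      exact (Polynomial.isRoot_map_iff (algebraMap ℝ ℂ).injective).mpr this
    have := norm_le_secondModulus hz (by exact_mod_cast hy1)
    rwa [Complex.norm_real] at this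
  have hW' : W *ᵥ v = A *ᵥ v := by
    funext i
    rw [hAv, hv]; ring
  have hn : ∀ u : Fin m → ℝ, ∑ i, u i ^ 2 = ∑ i, inner ℝ (hAh.eigenvectorBasis i)
      (WithLp.toLp 2 u) ^ 2 := by
    intro u
    have := hAh.eigenvectorBasis.sum_sq_norm_inner_right (WithLp.toLp 2 u)
    rw [EuclideanSpace.norm_sq_eq] at this
    simpa using this.symm
  have hin : ∀ i, inner ℝ (hAh.eigenvectorBasis i) (WithLp.toLp 2 (A *ᵥ v))
      = hAh.eigenvalues i * inner ℝ (hAh.eigenvectorBasis i) (WithLp.toLp 2 v) := by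
    intro i
    have hb : A *ᵥ ⇑(hAh.eigenvectorBasis i)
        = hAh.eigenvalues i • ⇑(hAh.eigenvectorBasis i) := hAh.mulVec_eigenvectorBasis i
    have hsym : Aᵀ = A := by
      rw [← Matrix.conjTranspose_eq_transpose_of_trivial]; exact hAh
    rw [EuclideanSpace.inner_eq_star_dotProduct, EuclideanSpace.inner_eq_star_dotProduct]
    simp only [star_trivial]
    rw [dotProduct_comm, Matrix.dotProduct_mulVec, ← Matrix.mulVec_transpose, hsym, hb,
      smul_dotProduct, smul_eq_mul, dotProduct_comm]
  rw [hW', hn (A *ᵥ v), hn v, Finset.mul_sum]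
  refine Finset.sum_le_sum fun i _ => ?_
  rw [hin, mul_pow]
  refine mul_le_mul_of_nonneg_right ?_ (sq_nonneg _)
  rw [← sq_abs]
  exact pow_le_pow_left₀ (abs_nonneg _) (hev i) 2

/-- The inverse of the spectral gap is at most the mixing factor `1 / ln (1 / λ(H))`. -/
theorem IsErgodicUniform.one_div_gap_le {M : ℕ} {H : Matrix (Fin M) (Fin M) ℝ}
    (hH : IsErgodicUniform H) :
    1 / (1 - secondModulus H) ≤ 1 / Real.log (1 / lambdaH H) := by
  have h1 := hH.secondModulus_lt_one
  have h0 := secondModulus_nonneg H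
  have hl : 0 < lambdaH H := by rw [lambdaH]; linarith
  have hl1 : lambdaH H < 1 := by rw [lambdaH]; linarith
  refine one_div_le_one_div_of_le (Real.log_pos ((one_lt_div hl).mpr hl1)) ?_
  -- From `log t ≤ t - 1` at `t = 1 / λ(H)`: the value `(1 - ρ) / (1 + ρ)` is at most `1 - ρ`.
  refine (Real.log_le_sub_one_of_pos (one_div_pos.mpr hl)).trans ?_
  rw [div_sub_one hl.ne', div_le_iff₀ hl, lambdaH]
  nlinarith

end Matrices

/-! ### Invariance and second moments of the uniform law on the sphere -/

section Sphere

open scoped Pointwise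

/-- The action of a linear isometry on the unit sphere. -/
noncomputable def sphereMap {n : ℕ} (A : Rn n ≃ₗᵢ[ℝ] Rn n) (h : UnitSphere n) : UnitSphere n :=
  ⟨A h, by simp⟩

theorem measurable_sphereMap {n : ℕ} (A : Rn n ≃ₗᵢ[ℝ] Rn n) : Measurable (sphereMap A) :=
  (A.continuous.measurable.comp measurable_subtype_coe).subtype_mk

/-- The surface measure of `s` is a multiple of the volume of the cone `(0,1) • s`, and an isometry
carries cones to cones preserving volume. -/
theorem toSphere_map_sphereMap {n : ℕ} (A : Rn n ≃ₗᵢ[ℝ] Rn n) :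
    (volume : Measure (Rn n)).toSphere.map (sphereMap A) = (volume : Measure (Rn n)).toSphere := by
  ext s hs
  rw [Measure.map_apply (measurable_sphereMap A) hs,
    Measure.toSphere_apply' _ (measurable_sphereMap A hs), Measure.toSphere_apply' _ hs]
  congr 1
  have : Set.Ioo (0 : ℝ) 1 • ((↑) '' (sphereMap A ⁻¹' s) : Set (Rn n))
      = A ⁻¹' (Set.Ioo (0 : ℝ) 1 • ((↑) '' s : Set (Rn n))) := by
    ext x
    simp only [Set.mem_smul, Set.mem_preimage]
    constructor
    · rintro ⟨t, ht, _, ⟨u, hu, rfl⟩, rfl⟩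
      exact ⟨t, ht, A u, ⟨sphereMap A u, hu, rfl⟩, by simp⟩
    · rintro ⟨t, ht, _, ⟨u, hu, rfl⟩, hx⟩
      refine ⟨t, ht, A.symm u, ⟨sphereMap A.symm u, ?_, rfl⟩, ?_⟩
      · have : sphereMap A (sphereMap A.symm u) = u := Subtype.ext (by simp [sphereMap])
        rwa [Set.mem_preimage, this]
      · apply A.injective
        rw [← hx]
        simp
  rw [this]
  exact A.measurePreserving.measure_preimage_emb A.toHomeomorph.measurableEmbedding _

theorem sphereUniform_map_sphereMap {n : ℕ} (A : Rn n ≃ₗᵢ[ℝ] Rn n) :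
    (sphereUniform n).map (sphereMap A) = sphereUniform n := by
  rw [sphereUniform, ProbabilityTheory.cond, Measure.restrict_univ, Measure.map_smul,
    toSphere_map_sphereMap]

theorem integral_sphereMap {n : ℕ} (A : Rn n ≃ₗᵢ[ℝ] Rn n) {g : UnitSphere n → ℝ}
    (hg : Measurable g) :
    ∫ h, g (sphereMap A h) ∂(sphereUniform n) = ∫ h, g h ∂(sphereUniform n) := by
  conv_rhs => rw [← sphereUniform_map_sphereMap A]
  exact (integral_map (measurable_sphereMap A).aemeasurable hg.aestronglyMeasurable).symm

theorem measurable_sphere_apply {n : ℕ} (a : Fin n) :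
    Measurable fun h : UnitSphere n => (h : Rn n) a := by
  fun_prop

theorem abs_sphere_apply_le {n : ℕ} (h : UnitSphere n) (a : Fin n) : |(h : Rn n) a| ≤ 1 := by
  have := PiLp.norm_apply_le (h : Rn n) a
  simpa using this

/-- The second moments of the uniform distribution on the sphere. -/
theorem integral_sphere_mul {n : ℕ} [IsProbabilityMeasure (sphereUniform n)] (a b : Fin n) :
    ∫ h, (h : Rn n) a * (h : Rn n) b ∂(sphereUniform n) = if a = b then 1 / (n : ℝ) else 0 := by
  -- Swapping coordinates makes the diagonal moments equal, and they sum to `1`; reflecting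
  -- coordinate `a` changes the sign of a mixed moment.
  have hmeas : ∀ a b : Fin n, Measurable fun h : UnitSphere n => (h : Rn n) a * (h : Rn n) b :=
    fun a b => (measurable_sphere_apply a).mul (measurable_sphere_apply b)
  split_ifs with hab
  · subst hab
    have hswap : ∀ b, ∫ h, (h : Rn n) b * (h : Rn n) b ∂(sphereUniform n)
        = ∫ h, (h : Rn n) a * (h : Rn n) a ∂(sphereUniform n) := by
      intro b
      rw [← integral_sphereMap (LinearIsometryEquiv.piLpCongrLeft 2 ℝ ℝ (Equiv.swap a b))
        (hmeas a a)]
      simp [sphereMap, Equiv.piCongrLeft'_apply]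
    have hint : ∀ b, Integrable (fun h : UnitSphere n => (h : Rn n) b * (h : Rn n) b)
        (sphereUniform n) := fun b =>
      Integrable.of_bound (hmeas b b).aestronglyMeasurable 1 (ae_of_all _ fun h => by
        have := abs_sphere_apply_le h b
        rw [Real.norm_eq_abs, abs_mul]
        nlinarith [abs_nonneg ((h : Rn n) b)])
    have hsum : ∑ b, ∫ h, (h : Rn n) b * (h : Rn n) b ∂(sphereUniform n) = 1 := by
      rw [← integral_finsetSum _ fun b _ => hint b]
      have : ∀ h : UnitSphere n, ∑ b, (h : Rn n) b * (h : Rn n) b = 1 := by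
        intro h
        have h1 := EuclideanSpace.norm_sq_eq (h : Rn n)
        rw [norm_eq_of_mem_sphere h] at h1
        simpa [← pow_two] using h1.symm
      simp [this]
    rw [Finset.sum_congr rfl fun b _ => hswap b, Finset.sum_const, Finset.card_univ,
      Fintype.card_fin, nsmul_eq_mul] at hsum
    have hn : (n : ℝ) ≠ 0 := by
      have := a.pos
      positivity
    rw [eq_div_iff hn, mul_comm]
    exact hsum
  · have h1 := integral_sphereMap (LinearIsometryEquiv.piLpCongrRight 2 fun i : Fin n =>
      if i = a then LinearIsometryEquiv.neg ℝ else LinearIsometryEquiv.refl ℝ ℝ) (hmeas a b)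
    simp [sphereMap, Ne.symm hab, integral_neg] at h1
    linarith

end Sphere

/-! ### Summation lemmas and step sizes -/

section Sequences

/-- Abel summation for a difference of two sequences, one nearly the shift of the other. -/
theorem abs_sum_mul_sub_le {γ u v : ℕ → ℝ} {Q c : ℝ} (hγ : Antitone γ) (hγ0 : ∀ k, 0 ≤ γ k)
    (hu : ∀ k, |u k| ≤ Q) (huv : ∀ k, |u (k + 1) - v k| ≤ c * γ k) (N : ℕ) :
    |∑ k ∈ Finset.range N, γ k * (u k - v k)|
      ≤ 3 * Q * γ 0 + c * ∑ k ∈ Finset.range N, γ k ^ 2 := by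
  have hQ : 0 ≤ Q := (abs_nonneg _).trans (hu 0)
  -- Shifting `u k` to `u (k + 1)` leaves boundary terms, the small differences `u (k + 1) - v k`,
  -- and the decrements of `γ`, which telescope.
  have h1 : ∀ N, ∑ k ∈ Finset.range N, γ k * (u k - v k) = γ 0 * u 0 - γ N * u N
      + ∑ k ∈ Finset.range N, (γ k * (u (k + 1) - v k) - (γ k - γ (k + 1)) * u (k + 1)) := by
    intro N
    induction N with
    | zero => simp
    | succ N ih => rw [Finset.sum_range_succ, Finset.sum_range_succ, ih]; ring
  have h2 : |∑ k ∈ Finset.range N, (γ k * (u (k + 1) - v k) - (γ k - γ (k + 1)) * u (k + 1))|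
      ≤ ∑ k ∈ Finset.range N, (c * γ k ^ 2 + (γ k - γ (k + 1)) * Q) := by
    refine (Finset.abs_sum_le_sum_abs _ _).trans (Finset.sum_le_sum fun k _ => ?_)
    refine (abs_sub _ _).trans (add_le_add ?_ ?_)
    · rw [abs_mul, abs_of_nonneg (hγ0 k)]
      nlinarith [huv k, hγ0 k]
    · have := sub_nonneg.mpr (hγ k.le_succ)
      rw [abs_mul, abs_of_nonneg this]
      exact mul_le_mul_of_nonneg_left (hu _) this
  rw [Finset.sum_add_distrib, ← Finset.mul_sum, ← Finset.sum_mul, Finset.sum_range_sub'] at h2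
  have h3 : |γ 0 * u 0 - γ N * u N| ≤ γ 0 * Q + γ N * Q := by
    refine (abs_sub _ _).trans (add_le_add ?_ ?_) <;>
    · rw [abs_mul, abs_of_nonneg (hγ0 _)]
      exact mul_le_mul_of_nonneg_left (hu _) (hγ0 _)
  rw [h1]
  refine (abs_add_le _ _).trans ?_
  have h4 := mul_le_mul_of_nonneg_right (hγ (Nat.zero_le N)) hQ
  have h5 := mul_nonneg (hγ0 N) hQ
  linarith

/-- The weighted sum of the solution of a perturbed linear contraction. -/
theorem sum_mul_contraction_le {γ c : ℕ → ℝ} {q K : ℝ} (hγ : Antitone γ) (hγ0 : ∀ k, 0 ≤ γ k)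
    (hq1 : q < 1) (hc : ∀ k, 0 ≤ c k) (hc0 : c 0 = 0)
    (hrec : ∀ k, c (k + 1) = q * c k + K * γ k) (N : ℕ) :
    ∑ k ∈ Finset.range N, γ k * c k
      ≤ K * (1 / (1 - q)) * ∑ k ∈ Finset.range N, γ k ^ 2 := by
  -- The recursion is multiplied by `γ (k + 1) ≤ γ k`, so the weighted sum is bounded by `q` times
  -- itself plus the forcing term.
  have h1 : ∀ N, ∑ k ∈ Finset.range (N + 1), γ k * c k
      ≤ q * ∑ k ∈ Finset.range N, γ k * c k + K * ∑ k ∈ Finset.range N, γ k ^ 2 := by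
    intro N
    rw [Finset.sum_range_succ', hc0, mul_zero, add_zero, Finset.mul_sum, Finset.mul_sum,
      ← Finset.sum_add_distrib]
    refine Finset.sum_le_sum fun k _ => ?_
    have h2 := mul_le_mul_of_nonneg_right (hγ k.le_succ) (hc (k + 1))
    rw [hrec] at h2 ⊢
    simp only [Nat.succ_eq_add_one] at h2
    linarith
  have h3 : ∑ k ∈ Finset.range N, γ k * c k ≤ ∑ k ∈ Finset.range (N + 1), γ k * c k := by
    rw [Finset.sum_range_succ]
    linarith [mul_nonneg (hγ0 N) (hc N)]
  have h4 := h3.trans (h1 N)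
  have hq' : 0 < 1 - q := by linarith
  rw [mul_assoc, mul_comm (1 / (1 - q)), mul_one_div, ← mul_div_assoc, le_div_iff₀ hq']
  linarith

/-- A nonnegative sequence of small increments whose square is summable against weights of
infinite sum tends to zero. -/
theorem tendsto_zero_of_weighted_summable {γ a : ℕ → ℝ} {K c : ℝ} (hγ0 : ∀ k, 0 ≤ γ k)
    (hγ : ¬ Summable γ) (hγ3 : Summable fun k => γ k ^ 3) (ha : ∀ k, 0 ≤ a k)
    (hK : ∀ N, ∑ k ∈ Finset.range N, γ k * a k ^ 2 ≤ K)
    (hinc : ∀ k, |a (k + 1) - a k| ≤ c * γ k) (hc : 0 ≤ c) : Tendsto a atTop (𝓝 0) := by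
  have hsum : Summable fun k => γ k * a k ^ 2 :=
    summable_of_sum_range_le (fun k => mul_nonneg (hγ0 k) (sq_nonneg _)) hK
  -- Cubes are used because an increment of `a ^ 3` is about `a ^ 2` times an increment of `a`, that
  -- is `O(γ a ^ 2)`, which is summable. So `a ^ 3` converges; a positive limit would make `γ`
  -- itself summable.
  have hcube : ∀ k, dist (a k ^ 3) (a (k + 1) ^ 3)
      ≤ 6 * c * (γ k * a k ^ 2) + 6 * c ^ 3 * γ k ^ 3 := by
    intro k
    have h1 := hinc k
    have h2 : a (k + 1) ≤ a k + c * γ k := by linarith [(abs_le.mp h1).2]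
    have h3 := mul_nonneg hc (hγ0 k)
    have hfac : a k ^ 3 - a (k + 1) ^ 3
        = -((a (k + 1) - a k) * (a k ^ 2 + a k * a (k + 1) + a (k + 1) ^ 2)) := by ring
    have h4 : a k ^ 2 + a k * a (k + 1) + a (k + 1) ^ 2 ≤ 3 * (a k + c * γ k) ^ 2 := by
      nlinarith [ha k, ha (k + 1), mul_le_mul h2 h2 (ha (k + 1)) (add_nonneg (ha k) h3),
        mul_le_mul_of_nonneg_left h2 (ha k)]
    have h5 : 0 ≤ a k ^ 2 + a k * a (k + 1) + a (k + 1) ^ 2 := by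
      have := mul_nonneg (ha k) (ha (k + 1))
      positivity
    have h6 : (a k + c * γ k) ^ 2 ≤ 2 * a k ^ 2 + 2 * (c * γ k) ^ 2 := by
      nlinarith [sq_nonneg (a k - c * γ k)]
    rw [Real.dist_eq, hfac, abs_neg, abs_mul, abs_of_nonneg h5]
    calc _ ≤ (c * γ k) * (3 * (2 * a k ^ 2 + 2 * (c * γ k) ^ 2)) :=
          mul_le_mul h1 (h4.trans (by linarith)) h5 h3
      _ = _ := by ring
  obtain ⟨l, hl⟩ := cauchySeq_tendsto_of_complete (cauchySeq_of_dist_le_of_summable _ hcube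
    ((hsum.mul_left _).add (hγ3.mul_left _)))
  have hl0 : 0 ≤ l := ge_of_tendsto' hl fun k => pow_nonneg (ha k) 3
  have hlz : l = 0 := by
    by_contra hne
    have hlpos : 0 < l := lt_of_le_of_ne hl0 (Ne.symm hne)
    obtain ⟨e, he, hel⟩ : ∃ e : ℝ, 0 < e ∧ e ^ 3 < l := by
      refine ⟨min 1 (l / 2), lt_min one_pos (half_pos hlpos), ?_⟩
      have h1 : 0 < min 1 (l / 2) := lt_min one_pos (half_pos hlpos)
      have h2 : min 1 (l / 2) ≤ 1 := min_le_left _ _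
      have h3 : min 1 (l / 2) ≤ l / 2 := min_le_right _ _
      nlinarith [mul_pos h1 h1]
    refine hγ (Summable.of_norm_bounded_eventually_nat (hsum.mul_left (1 / e ^ 2)) ?_)
    filter_upwards [hl.eventually (lt_mem_nhds hel)] with k hk
    have h1 : e < a k := lt_of_pow_lt_pow_left₀ 3 (ha k) hk
    rw [Real.norm_eq_abs, abs_of_nonneg (hγ0 k), one_div, ← div_eq_inv_mul,
      le_div_iff₀ (by positivity)]
    exact mul_le_mul_of_nonneg_left (pow_le_pow_left₀ he.le h1.le 2) (hγ0 k)
  rw [hlz] at hl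
  rw [tendsto_order]
  refine ⟨fun b hb => Eventually.of_forall fun k => hb.trans_le (ha k), fun b hb => ?_⟩
  filter_upwards [hl.eventually (gt_mem_nhds (pow_pos hb 3))] with k hk
  exact lt_of_pow_lt_pow_left₀ 3 hb.le hk

/-! ### The step sizes -/

theorem stepSize_nonneg {θ : ℝ} {γ : ℕ → ℝ} (hγ : ∀ k, γ k = 1 / ((k : ℝ) + 1) ^ θ) (k : ℕ) :
    0 ≤ γ k := by
  rw [hγ]; positivity

theorem stepSize_antitone {θ : ℝ} (hθ : 0 ≤ θ) {γ : ℕ → ℝ}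
    (hγ : ∀ k, γ k = 1 / ((k : ℝ) + 1) ^ θ) : Antitone γ := by
  intro a b hab
  rw [hγ, hγ]
  have : (a : ℝ) ≤ b := by exact_mod_cast hab
  exact one_div_le_one_div_of_le (by positivity)
    (Real.rpow_le_rpow (by positivity) (by linarith) hθ)

theorem summable_stepSize_rpow {p : ℝ} : Summable (fun k : ℕ => 1 / ((k : ℝ) + 1) ^ p) ↔ 1 < p := by
  have := summable_nat_add_iff (f := fun k : ℕ => 1 / (k : ℝ) ^ p) 1
  rw [← Real.summable_one_div_nat_rpow, ← this]
  push_cast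
  rfl

theorem stepSize_pow {θ : ℝ} {γ : ℕ → ℝ} (hγ : ∀ k, γ k = 1 / ((k : ℝ) + 1) ^ θ) (d k : ℕ) :
    γ k ^ d = 1 / ((k : ℝ) + 1) ^ (θ * d) := by
  rw [hγ, div_pow, one_pow, Real.rpow_mul (by positivity), Real.rpow_natCast]

theorem summable_stepSize_pow {θ : ℝ} {γ : ℕ → ℝ}
    (hγ : ∀ k, γ k = 1 / ((k : ℝ) + 1) ^ θ) {d : ℕ} (hd : 1 < θ * d) :
    Summable fun k => γ k ^ d := by
  simp only [stepSize_pow hγ]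
  exact summable_stepSize_rpow.mpr hd

theorem not_summable_stepSize {θ : ℝ} (hθ : θ ≤ 1) {γ : ℕ → ℝ}
    (hγ : ∀ k, γ k = 1 / ((k : ℝ) + 1) ^ θ) : ¬ Summable γ := by
  have : γ = fun k : ℕ => 1 / ((k : ℝ) + 1) ^ θ := funext hγ
  rw [this, summable_stepSize_rpow]
  exact not_lt.mpr hθ

/-- Each of the `k` terms is at least `1 / (2 k) ^ θ ≥ 1 / (2 k ^ θ)`. -/
theorem rpow_le_sum_stepSize {θ : ℝ} (hθ : 0 ≤ θ) (hθ1 : θ ≤ 1) {γ : ℕ → ℝ}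
    (hγ : ∀ k, γ k = 1 / ((k : ℝ) + 1) ^ θ) {k : ℕ} (hk : 1 ≤ k) :
    (k : ℝ) ^ (1 - θ) / 2 ≤ ∑ i ∈ Finset.Icc 1 k, γ i := by
  have hk0 : (0 : ℝ) < k := by exact_mod_cast hk
  have hk1 : (1 : ℝ) ≤ k := by exact_mod_cast hk
  have h1 : ∀ i ∈ Finset.Icc 1 k, 1 / (2 * (k : ℝ) ^ θ) ≤ γ i := by
    intro i hi
    have hik : (i : ℝ) ≤ k := by exact_mod_cast (Finset.mem_Icc.mp hi).2
    rw [hγ]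
    refine one_div_le_one_div_of_le (by positivity) ?_
    calc ((i : ℝ) + 1) ^ θ ≤ (2 * k) ^ θ :=
          Real.rpow_le_rpow (by positivity) (by linarith) hθ
      _ = 2 ^ θ * (k : ℝ) ^ θ := Real.mul_rpow (by norm_num) hk0.le
      _ ≤ 2 * (k : ℝ) ^ θ := by
          refine mul_le_mul_of_nonneg_right ?_ (by positivity)
          calc (2 : ℝ) ^ θ ≤ 2 ^ (1 : ℝ) := Real.rpow_le_rpow_of_exponent_le (by norm_num) hθ1
            _ = 2 := Real.rpow_one 2
  have h2 := Finset.sum_le_sum h1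
  rw [Finset.sum_const, Nat.card_Icc, nsmul_eq_mul] at h2
  refine le_trans (le_of_eq ?_) h2
  rw [Real.rpow_sub hk0, Real.rpow_one]
  have : (0 : ℝ) < (k : ℝ) ^ θ := by positivity
  simp only [Nat.add_sub_cancel]
  field_simp

/-- The smallest term of a sequence whose squares have a bounded weighted sum. -/
theorem inf'_le_of_weighted_sum {θ : ℝ} (hθ : 0 ≤ θ) (hθ1 : θ ≤ 1) {γ a : ℕ → ℝ}
    (hγ : ∀ k, γ k = 1 / ((k : ℝ) + 1) ^ θ) (ha : ∀ k, 0 ≤ a k) {K : ℝ} (hK0 : 0 ≤ K)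
    (hK : ∀ N, ∑ k ∈ Finset.range N, γ k * a k ^ 2 ≤ K ^ 2) {k : ℕ} (hk : 1 ≤ k) :
    (Finset.Icc 1 k).inf' (Finset.nonempty_Icc.mpr hk) a
      ≤ 2 * K / (k : ℝ) ^ ((1 - θ) / 2) := by
  set μ := (Finset.Icc 1 k).inf' (Finset.nonempty_Icc.mpr hk) a with hμ
  have hk0 : (0 : ℝ) < k := by exact_mod_cast hk
  have hμ0 : 0 ≤ μ := Finset.le_inf' _ _ fun i _ => ha i
  have h1 : (∑ i ∈ Finset.Icc 1 k, γ i) * μ ^ 2 ≤ K ^ 2 := by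
    rw [Finset.sum_mul]
    calc ∑ i ∈ Finset.Icc 1 k, γ i * μ ^ 2 ≤ ∑ i ∈ Finset.Icc 1 k, γ i * a i ^ 2 :=
          Finset.sum_le_sum fun i hi => mul_le_mul_of_nonneg_left
            (pow_le_pow_left₀ hμ0 (Finset.inf'_le _ hi) 2) (stepSize_nonneg hγ i)
      _ ≤ ∑ i ∈ Finset.range (k + 1), γ i * a i ^ 2 := by
          refine Finset.sum_le_sum_of_subset_of_nonneg (fun i hi => ?_)
            fun i _ _ => mul_nonneg (stepSize_nonneg hγ i) (sq_nonneg _)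
          rw [Finset.mem_range]
          have := (Finset.mem_Icc.mp hi).2
          omega
      _ ≤ K ^ 2 := hK _
  have h2 := mul_le_mul_of_nonneg_right (rpow_le_sum_stepSize hθ hθ1 hγ hk) (sq_nonneg μ)
  have hp : (0 : ℝ) < (k : ℝ) ^ ((1 - θ) / 2) := by positivity
  have h3 : (k : ℝ) ^ (1 - θ) = ((k : ℝ) ^ ((1 - θ) / 2)) ^ 2 := by
    rw [← Real.rpow_natCast, ← Real.rpow_mul hk0.le]
    congr 1
    push_cast
    ring
  -- The inequalities give the factor `√2`; it is rounded up to `2`.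
  rw [le_div_iff₀ hp]
  refine le_of_sq_le_sq ?_ (by positivity)
  rw [h3] at h2
  nlinarith

end Sequences

/-! ### Taylor estimates and gradients of averages -/

section Gradients

/-- First order Taylor expansion of a function with a Lipschitz gradient. -/
theorem abs_sub_sub_inner_gradient_le {n : ℕ} {g : Rn n → ℝ} (hg : Differentiable ℝ g) {L : ℝ}
    (hL0 : 0 ≤ L) (hL : ∀ x y, ‖∇ g x - ∇ g y‖ ≤ L * ‖x - y‖) (x y : Rn n) :
    |g y - g x - inner ℝ (∇ g x) (y - x)| ≤ L * ‖y - x‖ ^ 2 := by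
  have h := (convex_closedBall x ‖y - x‖).norm_image_sub_le_of_norm_fderiv_le' (𝕜 := ℝ) (f := g)
    (φ := fderiv ℝ g x) (C := L * ‖y - x‖) (x := x) (y := y) (fun z _ => hg z)
    (fun z hz => by
      rw [← toDual_gradient, ← toDual_gradient, ← map_sub, LinearIsometryEquiv.norm_map]
      refine (hL z x).trans (mul_le_mul_of_nonneg_left ?_ hL0)
      rwa [mem_closedBall_iff_norm] at hz)
    (Metric.mem_closedBall_self (norm_nonneg _)) (by simp [dist_eq_norm])
  rw [Real.norm_eq_abs, mul_assoc, ← pow_two] at h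
  rwa [inner_gradient_left]

theorem abs_sub_le_of_gradient_le {n : ℕ} {g : Rn n → ℝ} (hg : Differentiable ℝ g) {B : ℝ}
    (hB : ∀ x, ‖∇ g x‖ ≤ B) (x y : Rn n) : |g y - g x| ≤ B * ‖y - x‖ := by
  refine convex_univ.norm_image_sub_le_of_norm_fderiv_le (𝕜 := ℝ) (f := g) (fun z _ => hg z)
    (fun z _ => ?_) (Set.mem_univ x) (Set.mem_univ y)
  rw [← toDual_gradient, LinearIsometryEquiv.norm_map]
  exact hB z

theorem gradient_const_mul_sum {n : ℕ} {ι : Type*} [Fintype ι] (c : ℝ) {g : ι → Rn n → ℝ}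
    (hg : ∀ i, Differentiable ℝ (g i)) (x : Rn n) :
    ∇ (fun y => c * ∑ i, g i y) x = c • ∑ i, ∇ (g i) x := by
  refine HasGradientAt.gradient ?_
  rw [hasGradientAt_iff_hasFDerivAt]
  have h := (HasFDerivAt.fun_sum (u := Finset.univ) fun i _ => (hg i x).hasFDerivAt).const_mul c
  refine h.congr_fderiv ?_
  simp [map_sum, toDual_gradient]

theorem norm_average_le {N : ℕ} {E : Type*} [NormedAddCommGroup E] [NormedSpace ℝ E]
    {v : Fin N → E} {K : ℝ} (hK : 0 ≤ K) (h : ∀ i, ‖v i‖ ≤ K) :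
    ‖(1 / (N : ℝ)) • ∑ i, v i‖ ≤ K := by
  rcases Nat.eq_zero_or_pos N with rfl | hN
  · simpa using hK
  have hN' : (0 : ℝ) < N := by exact_mod_cast hN
  rw [norm_smul, Real.norm_eq_abs, abs_of_pos (by positivity), one_div, inv_mul_le_iff₀ hN']
  refine (norm_sum_le _ _).trans ((Finset.sum_le_sum fun i _ => h i).trans (le_of_eq ?_))
  simp

end Gradients

namespace LossAssumptions

variable {n m M : ℕ} {B L : ℝ} {f : Fin m → Fin M → Rn n → ℝ}

theorem gradient_nodeLoss (hf : LossAssumptions B L f) (i : Fin m) (x : Rn n) :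
    ∇ (nodeLoss f i) x = (1 / (M : ℝ)) • ∑ s, ∇ (f i s) x :=
  gradient_const_mul_sum _ (hf.differentiable i) x

theorem differentiable_nodeLoss (hf : LossAssumptions B L f) (i : Fin m) :
    Differentiable ℝ (nodeLoss f i) :=
  (Differentiable.fun_sum fun s _ => hf.differentiable i s).const_mul _

theorem differentiable_objective (hf : LossAssumptions B L f) :
    Differentiable ℝ (objective f) :=
  (Differentiable.fun_sum fun i _ => hf.differentiable_nodeLoss i).const_mul _

theorem gradient_objective (hf : LossAssumptions B L f) (x : Rn n) :
    ∇ (objective f) x = (1 / (m : ℝ)) • ∑ i, ∇ (nodeLoss f i) x :=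
  gradient_const_mul_sum _ hf.differentiable_nodeLoss x

theorem norm_gradient_nodeLoss_le (hf : LossAssumptions B L f) (hB : 0 ≤ B) (i : Fin m)
    (x : Rn n) : ‖∇ (nodeLoss f i) x‖ ≤ B := by
  rw [hf.gradient_nodeLoss]
  exact norm_average_le hB fun s => hf.gradient_bound i s x

theorem norm_gradient_objective_le (hf : LossAssumptions B L f) (hB : 0 ≤ B)
    (x : Rn n) : ‖∇ (objective f) x‖ ≤ B := by
  rw [hf.gradient_objective]
  exact norm_average_le hB fun i => hf.norm_gradient_nodeLoss_le hB i x

theorem gradient_nodeLoss_lipschitz (hf : LossAssumptions B L f) (hL : 0 ≤ L) (i : Fin m)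
    (x y : Rn n) : ‖∇ (nodeLoss f i) x - ∇ (nodeLoss f i) y‖ ≤ L * ‖x - y‖ := by
  rw [hf.gradient_nodeLoss, hf.gradient_nodeLoss, ← smul_sub, ← Finset.sum_sub_distrib]
  exact norm_average_le (by positivity) fun s => hf.gradient_lipschitz i s x y

theorem gradient_objective_lipschitz (hf : LossAssumptions B L f) (hL : 0 ≤ L)
    (x y : Rn n) : ‖∇ (objective f) x - ∇ (objective f) y‖ ≤ L * ‖x - y‖ := by
  rw [hf.gradient_objective, hf.gradient_objective, ← smul_sub, ← Finset.sum_sub_distrib]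
  exact norm_average_le (by positivity) fun i => hf.gradient_nodeLoss_lipschitz hL i x y

theorem continuous_of_lipschitz {g : Rn n → Rn n} (hg : ∀ x y, ‖g x - g y‖ ≤ L * ‖x - y‖) :
    Continuous g := by
  refine (LipschitzWith.of_dist_le' (K := L) fun x y => ?_).continuous
  rw [dist_eq_norm, dist_eq_norm]
  exact hg x y

end LossAssumptions

/-! ### The two-point estimator -/

section TwoPoint

variable {n : ℕ} {g : Rn n → ℝ} {B L δ : ℝ}

theorem norm_twoPoint_le (hg : Differentiable ℝ g) (hB : ∀ x, ‖∇ g x‖ ≤ B) (hδ : 0 < δ)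
    (h : UnitSphere n) (x : Rn n) : ‖twoPoint g δ h x‖ ≤ n * B := by
  have hh : ‖(h : Rn n)‖ = 1 := norm_eq_of_mem_sphere h
  have h1 := abs_sub_le_of_gradient_le hg hB x (x + δ • (h : Rn n))
  rw [add_sub_cancel_left, norm_smul, hh, mul_one, Real.norm_eq_abs, abs_of_pos hδ] at h1
  rw [twoPoint, norm_smul, hh, mul_one, Real.norm_eq_abs, abs_div, abs_mul, abs_of_pos hδ,
    Nat.abs_cast, div_le_iff₀ hδ, mul_assoc]
  exact mul_le_mul_of_nonneg_left h1 (Nat.cast_nonneg n)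

/-- The Taylor remainder is at most `L δ ^ 2`, hence `L δ` after division by `δ`. What remains is a
quadratic form in `h`, whose expectation is explicit, so no smoothed function is needed. -/
theorem inner_twoPoint_ge (hg : Differentiable ℝ g) (hL0 : 0 ≤ L)
    (hL : ∀ x y, ‖∇ g x - ∇ g y‖ ≤ L * ‖x - y‖) (hδ : 0 < δ) (h : UnitSphere n) (x : Rn n)
    {U : Rn n} (hU : ‖U‖ ≤ B) :
    n * (inner ℝ (∇ g x) (h : Rn n) * inner ℝ U (h : Rn n)) - B * n * L * δ
      ≤ inner ℝ U (twoPoint g δ h x) := by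
  have hh : ‖(h : Rn n)‖ = 1 := norm_eq_of_mem_sphere h
  have h1 := abs_sub_sub_inner_gradient_le hg hL0 hL x (x + δ • (h : Rn n))
  rw [add_sub_cancel_left, norm_smul, hh, mul_one, Real.norm_eq_abs, sq_abs,
    real_inner_smul_right] at h1
  set r := g (x + δ • (h : Rn n)) - g x - δ * inner ℝ (∇ g x) (h : Rn n) with hr
  have h2 : inner ℝ U (twoPoint g δ h x)
      = n * (inner ℝ (∇ g x) (h : Rn n) * inner ℝ U (h : Rn n))
        + n * (r / δ * inner ℝ U (h : Rn n)) := by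
    rw [twoPoint, real_inner_smul_right]
    field_simp
    rw [hr]
    ring
  have h3 : |r / δ * inner ℝ U (h : Rn n)| ≤ L * δ * B := by
    have h4 := abs_real_inner_le_norm U (h : Rn n)
    rw [hh, mul_one] at h4
    rw [abs_mul]
    refine mul_le_mul ?_ (h4.trans hU) (abs_nonneg _) (by positivity)
    rw [abs_div, abs_of_pos hδ, div_le_iff₀ hδ, mul_assoc, ← pow_two]
    exact h1
  have h5 := mul_le_mul_of_nonneg_left (abs_le.mp h3).1 (Nat.cast_nonneg (α := ℝ) n)
  rw [h2]
  linarith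

end TwoPoint

/-! ### Consensus -/

section Consensus

variable {n m : ℕ}

/-- The distance of the local variables from their average. -/
noncomputable def dispersion (x : Fin m → Rn n) : ℝ :=
  ‖(WithLp.toLp 2 fun i => x i - nodeAverage x : PiLp 2 fun _ : Fin m => Rn n)‖

theorem norm_sub_nodeAverage_le (x : Fin m → Rn n) (i : Fin m) :
    ‖x i - nodeAverage x‖ ≤ dispersion x :=
  PiLp.norm_apply_le (WithLp.toLp 2 fun i => x i - nodeAverage x : PiLp 2 fun _ : Fin m => Rn n) i

theorem norm_nodeAverage_le {x : Fin m → Rn n} {K : ℝ} (hK : 0 ≤ K) (h : ∀ i, ‖x i‖ ≤ K) :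
    ‖nodeAverage x‖ ≤ K := norm_average_le hK h

theorem sum_sub_nodeAverage (x : Fin m → Rn n) : ∑ i, (x i - nodeAverage x) = 0 := by
  rcases Nat.eq_zero_or_pos m with rfl | hm
  · simp
  have hm' : (m : ℝ) ≠ 0 := by positivity
  rw [Finset.sum_sub_distrib, nodeAverage, Finset.sum_const, Finset.card_univ, Fintype.card_fin,
    ← Nat.cast_smul_eq_nsmul ℝ, smul_smul, mul_one_div, div_self hm', one_smul, sub_self]

theorem nodeAverage_step {G : SimpleGraph (Fin m)} {W : Matrix (Fin m) (Fin m) ℝ}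
    (hW : IsMixingMatrix G W) (x d : Fin m → Rn n) (c : ℝ) :
    nodeAverage (fun i => ∑ l, W i l • x l - c • d i) = nodeAverage x - c • nodeAverage d := by
  simp only [nodeAverage]
  rw [Finset.sum_sub_distrib, Finset.sum_comm, ← Finset.smul_sum, smul_sub, smul_comm]
  congr 2
  refine Finset.sum_congr rfl fun l _ => ?_
  rw [← Finset.sum_smul, hW.sum_col, one_smul]

/-- The scalar contraction, applied to each coordinate of `ℝⁿ` separately. -/
theorem norm_mixing_le {G : SimpleGraph (Fin m)} {W : Matrix (Fin m) (Fin m) ℝ}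
    (hW : IsMixingMatrix G W) {e : Fin m → Rn n} (he : ∑ i, e i = 0) :
    ‖(WithLp.toLp 2 fun i => ∑ l, W i l • e l : PiLp 2 fun _ : Fin m => Rn n)‖
      ≤ secondModulus W * ‖(WithLp.toLp 2 e : PiLp 2 fun _ : Fin m => Rn n)‖ := by
  refine abs_le_of_sq_le_sq' ?_ (mul_nonneg (secondModulus_nonneg W) (norm_nonneg _)) |>.2
  rw [mul_pow, PiLp.norm_sq_eq_of_L2, PiLp.norm_sq_eq_of_L2]
  simp only [EuclideanSpace.norm_sq_eq, Real.norm_eq_abs, sq_abs]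
  rw [Finset.sum_comm, Finset.sum_comm (f := fun i a => (e i) a ^ 2), Finset.mul_sum]
  refine Finset.sum_le_sum fun a _ => ?_
  have h := hW.contraction (v := fun i => e i a) (by
    have := congrArg (fun v : Rn n => v a) he
    simpa using this)
  refine le_trans (le_of_eq (Finset.sum_congr rfl fun i _ => ?_)) h
  simp [Matrix.mulVec, dotProduct]

/-- Deviations from the average evolve by `e ↦ W e - c (d - mean d)`. The last vector has norm at
most `√m · 2K`, rounded up to `2 m K`. -/
theorem dispersion_step {G : SimpleGraph (Fin m)} {W : Matrix (Fin m) (Fin m) ℝ}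
    (hW : IsMixingMatrix G W) (x d : Fin m → Rn n) {c K : ℝ} (hc : 0 ≤ c) (hK : 0 ≤ K)
    (hd : ∀ i, ‖d i‖ ≤ K) :
    dispersion (fun i => ∑ l, W i l • x l - c • d i)
      ≤ secondModulus W * dispersion x + 2 * m * K * c := by
  have heq : (WithLp.toLp 2 fun i => (∑ l, W i l • x l - c • d i)
      - nodeAverage (fun i => ∑ l, W i l • x l - c • d i) : PiLp 2 fun _ : Fin m => Rn n)
      = (WithLp.toLp 2 fun i => ∑ l, W i l • (x l - nodeAverage x) : PiLp 2 fun _ : Fin m => Rn n)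
        - c • (WithLp.toLp 2 fun i => d i - nodeAverage d : PiLp 2 fun _ : Fin m => Rn n) := by
    refine PiLp.ext fun i => ?_
    simp only [PiLp.sub_apply, PiLp.smul_apply]
    rw [nodeAverage_step hW]
    simp only [smul_sub, Finset.sum_sub_distrib, ← Finset.sum_smul, hW.sum_row, one_smul]
    abel
  rw [dispersion, heq]
  refine (norm_sub_le _ _).trans (add_le_add (norm_mixing_le hW (sum_sub_nodeAverage x)) ?_)
  rw [norm_smul, Real.norm_eq_abs, abs_of_nonneg hc, mul_comm]
  refine mul_le_mul_of_nonneg_right ?_ hc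
  refine abs_le_of_sq_le_sq' ?_ (by positivity) |>.2
  rw [PiLp.norm_sq_eq_of_L2]
  calc ∑ i, ‖d i - nodeAverage d‖ ^ 2 ≤ ∑ _i : Fin m, (2 * K) ^ 2 :=
        Finset.sum_le_sum fun i _ => pow_le_pow_left₀ (norm_nonneg _)
          ((norm_sub_le _ _).trans (by linarith [hd i, norm_nodeAverage_le hK hd])) 2
    _ = m * (2 * K) ^ 2 := by simp
    _ ≤ (2 * m * K) ^ 2 := by
        rcases Nat.eq_zero_or_pos m with rfl | hm
        · simp
        have : (1 : ℝ) ≤ m := by exact_mod_cast hm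
        nlinarith [mul_nonneg (sq_nonneg K) (mul_nonneg (by positivity : (0 : ℝ) ≤ m)
          (sub_nonneg.mpr this))]

/-- The solution of `c (k + 1) = q c k + K γ k`, `c 0 = 0`. -/
def consensusBound (q K : ℝ) (γ : ℕ → ℝ) : ℕ → ℝ
  | 0 => 0
  | k + 1 => q * consensusBound q K γ k + K * γ k

theorem consensusBound_nonneg {q K : ℝ} (hq : 0 ≤ q) (hK : 0 ≤ K) {γ : ℕ → ℝ}
    (hγ : ∀ k, 0 ≤ γ k) (k : ℕ) : 0 ≤ consensusBound q K γ k := by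
  induction k with
  | zero => exact le_rfl
  | succ k ih => exact add_nonneg (mul_nonneg hq ih) (mul_nonneg hK (hγ k))

end Consensus

/-! ### The paths of the algorithm -/

section Path

variable {n m M : ℕ} {G : SimpleGraph (Fin m)} {W : Matrix (Fin m) (Fin m) ℝ} {B L : ℝ}
  {f : Fin m → Fin M → Rn n → ℝ} {γ δ : ℕ → ℝ} {x₀ : Rn n}

theorem nodeAverage_zoDMGD_succ (hW : IsMixingMatrix G W) (j : Fin m → ℕ → Fin M)
    (h : Fin m → ℕ → UnitSphere n) (k : ℕ) :
    nodeAverage (zoDMGD W f γ δ x₀ j h (k + 1))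
      = nodeAverage (zoDMGD W f γ δ x₀ j h k) - γ k • nodeAverage fun i =>
        twoPoint (f i (j i k)) (δ k) (h i k : Rn n) (zoDMGD W f γ δ x₀ j h k i) :=
  nodeAverage_step hW _ _ _

theorem norm_nodeAverage_zoDMGD_succ_sub_le (hW : IsMixingMatrix G W)
    (hf : LossAssumptions B L f) (hB : 0 ≤ B) (hγ : ∀ k, 0 ≤ γ k) (hδ : ∀ k, 0 < δ k)
    (j : Fin m → ℕ → Fin M) (h : Fin m → ℕ → UnitSphere n) (k : ℕ) :
    ‖nodeAverage (zoDMGD W f γ δ x₀ j h (k + 1)) - nodeAverage (zoDMGD W f γ δ x₀ j h k)‖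
      ≤ n * B * γ k := by
  rw [nodeAverage_zoDMGD_succ hW, sub_sub_cancel_left, norm_neg, norm_smul, Real.norm_eq_abs,
    abs_of_nonneg (hγ k), mul_comm]
  exact mul_le_mul_of_nonneg_right (norm_nodeAverage_le (by positivity) fun i =>
    norm_twoPoint_le (hf.differentiable _ _) (hf.gradient_bound _ _) (hδ k) _ _) (hγ k)

theorem dispersion_zoDMGD_le (hW : IsMixingMatrix G W)
    (hf : LossAssumptions B L f) (hB : 0 ≤ B) (hγ : ∀ k, 0 ≤ γ k) (hδ : ∀ k, 0 < δ k)
    (j : Fin m → ℕ → Fin M) (h : Fin m → ℕ → UnitSphere n) (k : ℕ) :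
    dispersion (zoDMGD W f γ δ x₀ j h k)
      ≤ consensusBound (secondModulus W) (2 * m * (n * B)) γ k := by
  induction k with
  | zero =>
    rcases Nat.eq_zero_or_pos m with rfl | hm
    · simp [dispersion, consensusBound, PiLp.norm_eq_of_L2]
    have hm' : (m : ℝ) ≠ 0 := by positivity
    have : nodeAverage (zoDMGD W f γ δ x₀ j h 0) = x₀ := by
      simp only [nodeAverage, zoDMGD, Finset.sum_const, Finset.card_univ, Fintype.card_fin]
      rw [← Nat.cast_smul_eq_nsmul ℝ, smul_smul, one_div_mul_cancel hm', one_smul]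
    rw [dispersion, this]
    simp [zoDMGD, consensusBound, PiLp.norm_eq_of_L2]
  | succ k ih =>
    refine (dispersion_step hW (zoDMGD W f γ δ x₀ j h k) _ (hγ k)
      (by positivity : 0 ≤ (n : ℝ) * B) fun i => norm_twoPoint_le
        (hf.differentiable _ _) (hf.gradient_bound _ _) (hδ k) (h i k) _).trans ?_
    rw [consensusBound]
    linarith [mul_le_mul_of_nonneg_left ih (secondModulus_nonneg W)]

/-- The descent inequality, summed along a path. -/
theorem sum_descent_le (hW : IsMixingMatrix G W)
    (hf : LossAssumptions B L f) (hB : 0 ≤ B) (hL : 0 ≤ L) (hγ : ∀ k, 0 ≤ γ k)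
    (hδ : ∀ k, 0 < δ k) {D : ℝ} (hD : ∀ x, objective f x₀ - objective f x ≤ D) (hm : 0 < m)
    (j : Fin m → ℕ → Fin M) (h : Fin m → ℕ → UnitSphere n) (N : ℕ) :
    ∑ k ∈ Finset.range N, γ k * ((1 / (m : ℝ)) * ∑ i,
        n * (inner ℝ (∇ (f i (j i k)) (zoDMGD W f γ δ x₀ j h k i)) (h i k : Rn n)
          * inner ℝ (∇ (objective f) (nodeAverage (zoDMGD W f γ δ x₀ j h k))) (h i k : Rn n)))
      ≤ D + L * (n * B) ^ 2 * ∑ k ∈ Finset.range N, γ k ^ 2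
        + B * n * L * ∑ k ∈ Finset.range N, γ k * δ k := by
  have hm' : (0 : ℝ) < m := by exact_mod_cast hm
  set x := zoDMGD W f γ δ x₀ j h with hx
  set y := fun k => nodeAverage (x k) with hy
  have hy0 : y 0 = x₀ := by
    simp only [hy, hx, nodeAverage, zoDMGD, Finset.sum_const, Finset.card_univ, Fintype.card_fin]
    rw [← Nat.cast_smul_eq_nsmul ℝ, smul_smul, one_div_mul_cancel hm'.ne', one_smul]
  -- A pathwise estimate: Taylor expansion of the objective from `y k` to `y (k + 1)`, with each
  -- estimator replaced by its quadratic form in `h` at the price `B n L δ k`.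
  have hstep : ∀ k, γ k * ((1 / (m : ℝ)) * ∑ i,
        n * (inner ℝ (∇ (f i (j i k)) (x k i)) (h i k : Rn n)
          * inner ℝ (∇ (objective f) (y k)) (h i k : Rn n)))
      ≤ (objective f (y k) - objective f (y (k + 1))) + L * (n * B) ^ 2 * γ k ^ 2
        + B * n * L * (γ k * δ k) := by
    intro k
    set U := ∇ (objective f) (y k) with hUdef
    have hU : ‖U‖ ≤ B := hf.norm_gradient_objective_le hB _
    set d := fun i => twoPoint (f i (j i k)) (δ k) (h i k : Rn n) (x k i) with hd
    have h1 := abs_sub_sub_inner_gradient_le hf.differentiable_objective hL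
      (hf.gradient_objective_lipschitz hL) (y k) (y (k + 1))
    have h2 : ‖y (k + 1) - y k‖ ≤ n * B * γ k :=
      norm_nodeAverage_zoDMGD_succ_sub_le hW hf hB hγ hδ j h k
    have h3 : y (k + 1) - y k = -(γ k • nodeAverage d) := by
      simp only [hy, hx, nodeAverage_zoDMGD_succ hW, sub_sub_cancel_left]
      rfl
    have h4 : inner ℝ U (y (k + 1) - y k) = -(γ k * ((1 / (m : ℝ)) * ∑ i, inner ℝ U (d i))) := by
      rw [h3, inner_neg_right, real_inner_smul_right, nodeAverage, real_inner_smul_right, inner_sum]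
    have h5 : L * ‖y (k + 1) - y k‖ ^ 2 ≤ L * (n * B * γ k) ^ 2 :=
      mul_le_mul_of_nonneg_left (pow_le_pow_left₀ (norm_nonneg _) h2 2) hL
    have h6 : (1 / (m : ℝ)) * ∑ i, n * (inner ℝ (∇ (f i (j i k)) (x k i)) (h i k : Rn n)
          * inner ℝ U (h i k : Rn n))
        ≤ (1 / (m : ℝ)) * ∑ i, inner ℝ U (d i) + B * n * L * δ k := by
      have h7 : ∑ i, n * (inner ℝ (∇ (f i (j i k)) (x k i)) (h i k : Rn n)
          * inner ℝ U (h i k : Rn n)) - m * (B * n * L * δ k) ≤ ∑ i, inner ℝ U (d i) := by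
        have : (m : ℝ) * (B * n * L * δ k) = ∑ _i : Fin m, B * n * L * δ k := by simp
        rw [this, ← Finset.sum_sub_distrib]
        exact Finset.sum_le_sum fun i _ => inner_twoPoint_ge (hf.differentiable _ _) hL
          (hf.gradient_lipschitz _ _) (hδ k) (h i k) (x k i) hU
      have h8 := mul_le_mul_of_nonneg_left h7 (by positivity : 0 ≤ 1 / (m : ℝ))
      rw [mul_sub, ← mul_assoc (1 / (m : ℝ)) (m : ℝ), one_div_mul_cancel hm'.ne', one_mul] at h8
      linarith
    have h9 := mul_le_mul_of_nonneg_left h6 (hγ k)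
    rw [h4] at h1
    have h10 := (abs_le.mp h1).2
    have h11 : L * (n * B * γ k) ^ 2 = L * (n * B) ^ 2 * γ k ^ 2 := by ring
    linarith
  refine (Finset.sum_le_sum fun k _ => hstep k).trans ?_
  rw [Finset.sum_add_distrib, Finset.sum_add_distrib, Finset.sum_range_sub', ← Finset.mul_sum,
    ← Finset.mul_sum, hy0]
  linarith [hD (y N)]

end Path

/-! ### Expectations along the random samples and directions -/

section Probability

theorem integrable_of_abs_le {Ω : Type*} [MeasurableSpace Ω] {P : Measure Ω} [IsFiniteMeasure P]
    {g : Ω → ℝ} (hg : Measurable g) {K : ℝ} (hK : ∀ ω, |g ω| ≤ K) : Integrable g P :=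
  Integrable.of_bound hg.aestronglyMeasurable K (ae_of_all _ hK)

theorem abs_integral_le_of_abs_le {Ω : Type*} [MeasurableSpace Ω] {P : Measure Ω}
    [IsProbabilityMeasure P] {g : Ω → ℝ} {K : ℝ} (hK : ∀ ω, |g ω| ≤ K) : |∫ ω, g ω ∂P| ≤ K := by
  have := norm_integral_le_of_norm_le_const (μ := P) (f := g) (C := K) (ae_of_all _ hK)
  simpa using this

/-! ### Random directions -/

/-- A uniform direction that is independent of the vectors `U` and `g` is isotropic. -/
theorem integral_inner_direction {Ω : Type*} {𝓐 : MeasurableSpace Ω} [mΩ : MeasurableSpace Ω]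
    {P : Measure Ω}
    [IsProbabilityMeasure P] {n : ℕ} {h : Ω → UnitSphere n} (hh : Measurable h)
    (hunif : P.map h = sphereUniform n) (h𝓐 : 𝓐 ≤ mΩ)
    (hind : Indep (MeasurableSpace.comap h inferInstance) 𝓐 P) {g U : Ω → Rn n}
    (hg : Measurable[𝓐] g) (hU : Measurable[𝓐] U) {B : ℝ} (hgB : ∀ ω, ‖g ω‖ ≤ B)
    (hUB : ∀ ω, ‖U ω‖ ≤ B) :
    ∫ ω, n * (inner ℝ (g ω) (h ω : Rn n) * inner ℝ (U ω) (h ω : Rn n)) ∂P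
      = ∫ ω, inner ℝ (U ω) (g ω) ∂P := by
  have hprob : IsProbabilityMeasure (sphereUniform n) := by
    rw [← hunif]; exact Measure.isProbabilityMeasure_map hh.aemeasurable
  have hcoord : ∀ {V : Ω → Rn n}, Measurable[𝓐] V → ∀ a, Measurable[𝓐] fun ω => V ω a :=
    fun hV a => (by fun_prop : Measurable fun v : Rn n => v a).comp hV
  have hm : ∀ a b, Measurable[𝓐] fun ω => g ω a * U ω b := fun a b =>
    (hcoord hg a).mul (hcoord hU b)
  have hs : ∀ a b, Measurable fun u : UnitSphere n => (u : Rn n) a * (u : Rn n) b :=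
    fun a b => (measurable_sphere_apply a).mul (measurable_sphere_apply b)
  have hbd : ∀ {V : Ω → Rn n}, (∀ ω, ‖V ω‖ ≤ B) → ∀ a ω, |V ω a| ≤ B := fun hV a ω =>
    (PiLp.norm_apply_le _ a).trans (hV ω)
  have hmb : ∀ a b ω, |g ω a * U ω b| ≤ B * B := fun a b ω => by
    rw [abs_mul]
    exact mul_le_mul (hbd hgB a ω) (hbd hUB b ω) (abs_nonneg _)
      ((norm_nonneg _).trans (hgB ω))
  have hsb : ∀ (a b : Fin n) (u : UnitSphere n), |(u : Rn n) a * (u : Rn n) b| ≤ 1 :=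
    fun a b u => by
      rw [abs_mul]
      exact mul_le_one₀ (abs_sphere_apply_le u a) (abs_nonneg _) (abs_sphere_apply_le u b)
  -- The product `g_a U_b` is `𝓐`-measurable, hence independent of `h_a h_b`, so the second moments
  -- of the sphere factor out.
  have hexp : ∀ a b, ∫ ω, (g ω a * U ω b) * ((h ω : Rn n) a * (h ω : Rn n) b) ∂P
      = (∫ ω, g ω a * U ω b ∂P) * if a = b then 1 / (n : ℝ) else 0 := by
    intro a b
    have hi : IndepFun (fun ω => g ω a * U ω b)
        (fun ω => (h ω : Rn n) a * (h ω : Rn n) b) P := by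
      rw [IndepFun_iff_Indep]
      refine indep_of_indep_of_le_left (indep_of_indep_of_le_right hind.symm ?_) ?_
      · exact (((hs a b).comp (comap_measurable h))).comap_le
      · exact (hm a b).comap_le
    rw [hi.integral_fun_mul_eq_mul_integral ((hm a b).mono h𝓐 le_rfl).aestronglyMeasurable
      ((hs a b).comp hh).aestronglyMeasurable, ← integral_sphere_mul a b, ← hunif,
      integral_map hh.aemeasurable (hs a b).aestronglyMeasurable]
  have hint : ∀ a b, Integrable
      (fun ω => (g ω a * U ω b) * ((h ω : Rn n) a * (h ω : Rn n) b)) P := fun a b => by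
    refine integrable_of_abs_le (((hm a b).mono h𝓐 le_rfl).mul ((hs a b).comp hh))
      (K := B * B) fun ω => ?_
    rw [abs_mul]
    have h1 := hmb a b ω
    have h2 := hsb a b (h ω)
    nlinarith [abs_nonneg (g ω a * U ω b), abs_nonneg ((h ω : Rn n) a * (h ω : Rn n) b)]
  have hpt : ∀ ω, (inner ℝ (g ω) (h ω : Rn n) * inner ℝ (U ω) (h ω : Rn n))
      = ∑ a, ∑ b, (g ω a * U ω b) * ((h ω : Rn n) a * (h ω : Rn n) b) := by
    intro ω
    simp only [PiLp.inner_apply, RCLike.inner_apply, conj_trivial]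
    rw [Finset.sum_mul_sum]
    exact Finset.sum_congr rfl fun a _ => Finset.sum_congr rfl fun b _ => by ring
  rw [integral_const_mul]
  simp only [hpt]
  rw [integral_finsetSum _ fun a _ => integrable_finsetSum _ fun b _ => hint a b]
  simp only [integral_finsetSum _ fun b _ => hint _ b, hexp, mul_ite, mul_zero,
    Finset.sum_ite_eq, Finset.mem_univ, if_true]
  rw [← Finset.sum_mul, ← integral_finsetSum _ fun a _ =>
    integrable_of_abs_le ((hm a a).mono h𝓐 le_rfl) (hmb a a)]
  rcases Nat.eq_zero_or_pos n with rfl | hn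
  · simp [Subsingleton.elim _ (0 : Rn 0)]
  have hn' : (n : ℝ) ≠ 0 := by positivity
  rw [mul_one_div, mul_div_cancel₀ _ hn']
  simp only [PiLp.inner_apply, RCLike.inner_apply, conj_trivial]

/-! ### Markov chains -/

section Markov

variable {Ω : Type*} [mΩ : MeasurableSpace Ω] {P : Measure Ω} [IsProbabilityMeasure P] {M : ℕ}
  {ℱ : ℕ → MeasurableSpace Ω} {H : Matrix (Fin M) (Fin M) ℝ} {X : ℕ → Ω → Fin M}

/-- The Markov property says that two finite measures agree on `ℱ k`: `P` restricted to the
transition event, and `H r s` times `P` restricted to `X k = r`. Hence they integrate `ℱ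
k`-measurable functions alike. -/
theorem IsMarkovChain.setIntegral_inter (hX : IsMarkovChain P ℱ H X) (hXm : ∀ k, Measurable (X k))
    {k : ℕ} (hℱ : ℱ k ≤ mΩ) {r s : Fin M} (hH : 0 ≤ H r s) {Y : Ω → ℝ} (hY : Measurable[ℱ k] Y) :
    ∫ ω in {ω | X k ω = r} ∩ {ω | X (k + 1) ω = s}, Y ω ∂P
      = H r s * ∫ ω in {ω | X k ω = r}, Y ω ∂P := by
  have hr : MeasurableSet {ω | X k ω = r} := hXm k (measurableSet_singleton r)
  have hs : MeasurableSet {ω | X (k + 1) ω = s} := hXm (k + 1) (measurableSet_singleton s)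
  have heq : (P.restrict ({ω | X k ω = r} ∩ {ω | X (k + 1) ω = s})).trim hℱ
      = (ENNReal.ofReal (H r s) • P.restrict {ω | X k ω = r}).trim hℱ := by
    refine @Measure.ext _ (ℱ k) _ _ fun A hA => ?_
    rw [trim_measurableSet_eq hℱ hA, trim_measurableSet_eq hℱ hA, Measure.smul_apply,
      Measure.restrict_apply (hℱ A hA), Measure.restrict_apply (hℱ A hA), smul_eq_mul,
      ← Set.inter_assoc]
    have h := hX k r s A hA
    rw [measureReal_def, measureReal_def] at h
    rw [← ENNReal.toReal_eq_toReal_iff' (measure_ne_top _ _)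
      (ENNReal.mul_ne_top ENNReal.ofReal_ne_top (measure_ne_top _ _)), h, ENNReal.toReal_mul,
      ENNReal.toReal_ofReal hH, mul_comm]
  have hYs : StronglyMeasurable[ℱ k] Y := hY.stronglyMeasurable
  rw [integral_trim hℱ hYs, heq, ← integral_trim hℱ hYs, integral_smul_measure,
    ENNReal.toReal_ofReal hH, smul_eq_mul]

/-- The Markov property for functions of the next state. -/
theorem IsMarkovChain.integral_next (hX : IsMarkovChain P ℱ H X) (hXm : ∀ k, Measurable (X k))
    {k : ℕ} (hℱ : ℱ k ≤ mΩ) (hH : ∀ r s, 0 ≤ H r s) {Y : Fin M → Ω → ℝ}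
    (hY : ∀ s, Measurable[ℱ k] (Y s)) {Q : ℝ} (hQ : ∀ s ω, |Y s ω| ≤ Q) :
    ∫ ω, Y (X (k + 1) ω) ω ∂P = ∫ ω, (H.mulVec fun s => Y s ω) (X k ω) ∂P := by
  have hr : ∀ r, MeasurableSet {ω | X k ω = r} := fun r => hXm k (measurableSet_singleton r)
  have hs : ∀ s, MeasurableSet {ω | X (k + 1) ω = s} :=
    fun s => hXm (k + 1) (measurableSet_singleton s)
  have hi : ∀ s, Integrable (Y s) P := fun s =>
    integrable_of_abs_le ((hY s).mono hℱ le_rfl) (hQ s)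
  have hl : ∀ ω, Y (X (k + 1) ω) ω
      = ∑ r, ∑ s, Set.indicator ({ω | X k ω = r} ∩ {ω | X (k + 1) ω = s}) (Y s) ω := by
    intro ω
    simp [Set.indicator_apply, ite_and]
  have hR : ∀ ω, (H.mulVec fun s => Y s ω) (X k ω)
      = ∑ r, ∑ s, H r s * Set.indicator {ω | X k ω = r} (Y s) ω := by
    intro ω
    simp only [Set.indicator_apply, Set.mem_ofPred_eq, mul_ite, mul_zero]
    rw [Finset.sum_comm]
    simp [Matrix.mulVec, dotProduct]
  simp only [hl, hR]
  rw [integral_finsetSum _ fun r _ => integrable_finsetSum _ fun s _ =>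
      (hi s).indicator ((hr r).inter (hs s)),
    integral_finsetSum _ fun r _ => integrable_finsetSum _ fun s _ =>
      ((hi s).indicator (hr r)).const_mul (H r s)]
  refine Finset.sum_congr rfl fun r _ => ?_
  rw [integral_finsetSum _ fun s _ => (hi s).indicator ((hr r).inter (hs s)),
    integral_finsetSum _ fun s _ => ((hi s).indicator (hr r)).const_mul (H r s)]
  refine Finset.sum_congr rfl fun s _ => ?_
  rw [integral_indicator ((hr r).inter (hs s)), integral_const_mul, integral_indicator (hr r),
    hX.setIntegral_inter hXm hℱ (hH r s) (hY s)]

theorem measurable_apply_index {Ω : Type*} [MeasurableSpace Ω] {M : ℕ} {E F : Type*}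
    [MeasurableSpace E] [MeasurableSpace F] {g : Fin M → E → F} (hg : ∀ s, Measurable (g s))
    {J : Ω → Fin M} (hJ : Measurable J) {Y : Ω → E} (hY : Measurable Y) :
    Measurable fun ω => g (J ω) (Y ω) :=
  (measurable_from_prod_countable_left (f := fun p : E × Fin M => g p.2 p.1) hg).comp
    (hY.prodMk hJ)

/-- The weighted average of a centred function of the chain and of a slowly varying process. -/
theorem IsMarkovChain.abs_sum_integral_le (hX : IsMarkovChain P ℱ H X)
    (hXm : ∀ k, Measurable (X k)) (hℱ : ∀ k, ℱ k ≤ mΩ) (hH : IsErgodicUniform H) {n : ℕ}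
    {φ : Fin M → Rn n → ℝ} (hφm : ∀ s, Measurable (φ s)) (hφ0 : ∀ y, ∑ s, φ s y = 0)
    {Φ Λ c : ℝ} (hΦ : ∀ s y, |φ s y| ≤ Φ) (hΛ : ∀ s y z, |φ s y - φ s z| ≤ Λ * ‖y - z‖)
    (hΛ0 : 0 ≤ Λ) {Y : ℕ → Ω → Rn n} (hY : ∀ k, Measurable[ℱ k] (Y k)) {γ : ℕ → ℝ}
    (hγ : Antitone γ) (hγ0 : ∀ k, 0 ≤ γ k) (hYγ : ∀ k ω, ‖Y (k + 1) ω - Y k ω‖ ≤ c * γ k)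
    (N : ℕ) :
    |∑ k ∈ Finset.range N, γ k * ∫ ω, φ (X k ω) (Y k ω) ∂P|
      ≤ (M * ((2 * (M : ℝ) ^ 2 + 2) * (1 / (1 - secondModulus H)))) *
        (3 * Φ * γ 0 + Λ * c * ∑ k ∈ Finset.range N, γ k ^ 2) := by
  set κ := (2 * (M : ℝ) ^ 2 + 2) * (1 / (1 - secondModulus H)) with hκ
  have hκ0 : 0 ≤ κ := by
    have := hH.secondModulus_lt_one
    exact mul_nonneg (by positivity) (one_div_nonneg.mpr (by linarith))
  have hZ : ∀ r s, |fundamentalMatrix H r s| ≤ κ := hH.abs_fundamentalMatrix_le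
  -- The Poisson solution for `φ · y` with `y` frozen; it inherits the bound and the Lipschitz
  -- constant of `φ` up to the factor `M * κ`.
  set q : Fin M → Rn n → ℝ := fun r y => (fundamentalMatrix H).mulVec (fun s => φ s y) r with hq
  have hsumZ : ∀ (r : Fin M) (v : Fin M → ℝ) (b : ℝ), (∀ s, |v s| ≤ b) →
      |∑ s, fundamentalMatrix H r s * v s| ≤ M * κ * b := by
    intro r v b hv
    refine (Finset.abs_sum_le_sum_abs _ _).trans ?_
    calc ∑ s, |fundamentalMatrix H r s * v s| ≤ ∑ _s : Fin M, κ * b :=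
          Finset.sum_le_sum fun s _ => by
            rw [abs_mul]; exact mul_le_mul (hZ r s) (hv s) (abs_nonneg _) hκ0
      _ = M * κ * b := by simp [mul_assoc]
  have hqm : ∀ r, Measurable (q r) := fun r => by
    change Measurable fun y => ∑ s, fundamentalMatrix H r s * φ s y
    exact Finset.measurable_sum _ fun s _ => (hφm s).const_mul _
  have hqb : ∀ r y, |q r y| ≤ M * κ * Φ := fun r y => hsumZ r _ _ fun s => hΦ s y
  have hql : ∀ r y z, |q r y - q r z| ≤ M * κ * (Λ * ‖y - z‖) := fun r y z => by
    have h1 : q r y - q r z = ∑ s, fundamentalMatrix H r s * (φ s y - φ s z) := by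
      simp only [hq, Matrix.mulVec, dotProduct, mul_sub, Finset.sum_sub_distrib]
    rw [h1]
    exact hsumZ r _ _ fun s => hΛ s y z
  have hYm : ∀ k, Measurable (Y k) := fun k => (hY k).mono (hℱ k) le_rfl
  have hm1 : ∀ k, Measurable fun ω => q (X k ω) (Y k ω) := fun k =>
    measurable_apply_index hqm (hXm k) (hYm k)
  have hm2 : ∀ k, Measurable fun ω => q (X (k + 1) ω) (Y k ω) := fun k =>
    measurable_apply_index hqm (hXm (k + 1)) (hYm k)
  have hi1 : ∀ k, Integrable (fun ω => q (X k ω) (Y k ω)) P := fun k =>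
    integrable_of_abs_le (hm1 k) fun ω => hqb _ _
  have hi2 : ∀ k, Integrable (fun ω => q (X (k + 1) ω) (Y k ω)) P := fun k =>
    integrable_of_abs_le (hm2 k) fun ω => hqb _ _
  -- Since `Y k` is known at time `k`, the term `H q` is the conditional expectation of `q` at the
  -- next state with `Y k` kept.
  have hdecomp : ∀ k, ∫ ω, φ (X k ω) (Y k ω) ∂P
      = ∫ ω, q (X k ω) (Y k ω) ∂P - ∫ ω, q (X (k + 1) ω) (Y k ω) ∂P := by
    intro k
    have hpt : ∀ ω, φ (X k ω) (Y k ω)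
        = q (X k ω) (Y k ω) - (H.mulVec fun s => q s (Y k ω)) (X k ω) := fun ω =>
      (hH.poisson (hφ0 (Y k ω)) (X k ω)).symm
    have hnext := hX.integral_next hXm (hℱ k)
      (fun r s => Matrix.nonneg_of_mem_rowStochastic hH.stochastic)
      (Y := fun s ω => q s (Y k ω)) (fun s => (hqm s).comp (hY k)) (fun s ω => hqb s _)
    rw [hnext, ← integral_sub (hi1 k)]
    · exact integral_congr_ae (ae_of_all _ hpt)
    · have : (fun ω => (H.mulVec fun s => q s (Y k ω)) (X k ω))
          = fun ω => q (X k ω) (Y k ω) - φ (X k ω) (Y k ω) := funext fun ω => by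
        rw [hpt ω]; ring
      rw [this]
      exact (hi1 k).sub (integrable_of_abs_le (measurable_apply_index hφm (hXm k) (hYm k))
        fun ω => hΦ _ _)
  simp only [hdecomp]
  -- Here `u (k + 1)` and `v k` share the state `X (k + 1)` and differ only in `Y (k + 1)` versus `Y
  -- k`, a change of size `c * γ k`.
  refine (abs_sum_mul_sub_le (Q := M * κ * Φ) (c := M * κ * (Λ * c)) hγ hγ0
    (fun k => abs_integral_le_of_abs_le fun ω => hqb _ _) (fun k => ?_) N).trans
    (le_of_eq (by ring))
  rw [← integral_sub (hi1 (k + 1)) (hi2 k)]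
  refine abs_integral_le_of_abs_le fun ω => (hql _ _ _).trans ?_
  rw [mul_assoc (M * κ : ℝ)]
  refine mul_le_mul_of_nonneg_left ?_ (by positivity)
  rw [mul_assoc]
  exact mul_le_mul_of_nonneg_left (hYγ k ω) hΛ0

end Markov

/-! ### Measurability of the iterates -/

theorem measurable_twoPoint_apply {Ω : Type*} [MeasurableSpace Ω] {n M : ℕ}
    {g : Fin M → Rn n → ℝ} (hg : ∀ s, Continuous (g s)) (δ : ℝ) {J : Ω → Fin M}
    (hJ : Measurable J) {h : Ω → UnitSphere n} (hh : Measurable h) {X : Ω → Rn n}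
    (hX : Measurable X) : Measurable fun ω => twoPoint (g (J ω)) δ (h ω : Rn n) (X ω) := by
  have hcont : ∀ s, Continuous fun p : Rn n × Rn n => twoPoint (g s) δ p.1 p.2 := fun s => by
    have := hg s
    unfold twoPoint
    fun_prop
  have hmeas : ∀ s, Measurable fun p : Rn n × Rn n => twoPoint (g s) δ p.1 p.2 :=
    fun s => (hcont s).measurable
  have hpair : Measurable fun ω => ((h ω : Rn n), X ω) :=
    (measurable_subtype_coe.comp hh).prodMk hX
  exact measurable_apply_index (g := fun s (p : Rn n × Rn n) => twoPoint (g s) δ p.1 p.2)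
    (Y := fun ω => ((h ω : Rn n), X ω)) hmeas hJ hpair

theorem measurable_zoDMGD {Ω : Type*} [MeasurableSpace Ω] {n m M : ℕ}
    {W : Matrix (Fin m) (Fin m) ℝ} {f : Fin m → Fin M → Rn n → ℝ}
    (hf : ∀ i s, Continuous (f i s)) {γ δ : ℕ → ℝ} {x₀ : Rn n} {j : Fin m → ℕ → Ω → Fin M}
    {h : Fin m → ℕ → Ω → UnitSphere n} {k : ℕ} (hj : ∀ i l, l < k → Measurable (j i l))
    (hh : ∀ i l, l < k → Measurable (h i l)) (i : Fin m) :
    Measurable fun ω => zoDMGD W f γ δ x₀ (fun i l => j i l ω) (fun i l => h i l ω) k i := by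
  induction k generalizing i with
  | zero => exact measurable_const
  | succ k ih =>
    have hx := ih (fun i l hl => hj i l (hl.trans k.lt_succ_self))
      fun i l hl => hh i l (hl.trans k.lt_succ_self)
    simp only [zoDMGD]
    exact (Finset.measurable_sum _ fun l _ => (hx l).const_smul (W i l)).sub
      ((measurable_twoPoint_apply (hf i) (δ k) (hj i k k.lt_succ_self) (hh i k k.lt_succ_self)
        (hx i)).const_smul (γ k))

section History

variable {Ω : Type*} {n m M : ℕ} {j : Fin m → ℕ → Ω → Fin M}
  {h : Fin m → ℕ → Ω → UnitSphere n}

theorem history_le [mΩ : MeasurableSpace Ω] (hj : ∀ i k, Measurable (j i k)) (hh : ∀ i k, Measurable (h i k)) (k : ℕ) :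
    history j h k ≤ mΩ :=
  iSup_le fun i => iSup_le fun l => iSup_le fun _ => sup_le (hj i l).comap_le (hh i l).comap_le

theorem preHistory_le [mΩ : MeasurableSpace Ω] (hj : ∀ i k, Measurable (j i k)) (hh : ∀ i k, Measurable (h i k)) (k : ℕ) :
    preHistory j h k ≤ mΩ :=
  sup_le (iSup_le fun i => iSup_le fun l => iSup_le fun _ => (hj i l).comap_le)
    (iSup_le fun i => iSup_le fun l => iSup_le fun _ => (hh i l).comap_le)

theorem measurable_sample_preHistory {k l : ℕ} (hl : l ≤ k) (i : Fin m) :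
    Measurable[preHistory j h k] (j i l) :=
  measurable_iff_comap_le.mpr <| le_sup_of_le_left <|
    le_iSup_of_le i <| le_iSup_of_le l <| le_iSup_of_le hl le_rfl

theorem measurable_direction_preHistory {k l : ℕ} (hl : l < k) (i : Fin m) :
    Measurable[preHistory j h k] (h i l) :=
  measurable_iff_comap_le.mpr <| le_sup_of_le_right <|
    le_iSup_of_le i <| le_iSup_of_le l <| le_iSup_of_le hl le_rfl

theorem preHistory_le_history (k : ℕ) : preHistory j h k ≤ history j h k :=
  sup_le
    (iSup_le fun i => iSup_le fun l => iSup_le fun hl =>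
      le_iSup_of_le i <| le_iSup_of_le l <| le_iSup_of_le hl le_sup_left)
    (iSup_le fun i => iSup_le fun l => iSup_le fun hl =>
      le_iSup_of_le i <| le_iSup_of_le l <| le_iSup_of_le hl.le le_sup_right)

theorem measurable_zoDMGD_preHistory {W : Matrix (Fin m) (Fin m) ℝ}
    {f : Fin m → Fin M → Rn n → ℝ} (hf : ∀ i s, Continuous (f i s)) {γ δ : ℕ → ℝ} {x₀ : Rn n}
    (k : ℕ) (i : Fin m) : Measurable[preHistory j h k]
      fun ω => zoDMGD W f γ δ x₀ (fun i l => j i l ω) (fun i l => h i l ω) k i :=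
  @measurable_zoDMGD Ω (preHistory j h k) n m M W f hf γ δ x₀ j h k
    (fun i _ hl => measurable_sample_preHistory hl.le i)
    (fun i _ hl => measurable_direction_preHistory hl i) i

end History

end Probability

theorem sq_integral_le_integral_sq {Ω : Type*} [MeasurableSpace Ω] {P : Measure Ω}
    [IsProbabilityMeasure P] {g : Ω → ℝ} (hg : Measurable g) {K : ℝ} (hK : ∀ ω, |g ω| ≤ K) :
    (∫ ω, g ω ∂P) ^ 2 ≤ ∫ ω, g ω ^ 2 ∂P := by
  have h1 : MemLp g 2 P := MemLp.of_bound hg.aestronglyMeasurable K (ae_of_all _ hK)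
  have h2 := variance_nonneg g P
  rw [variance_eq_sub h1] at h2
  simp only [Pi.pow_apply] at h2
  linarith

/-! ### Deviation of the sample gradients from the node gradients -/

namespace LossAssumptions

variable {n m M : ℕ} {B L : ℝ} {f : Fin m → Fin M → Rn n → ℝ}

/-- The deviation of the gradient of a sample loss from the gradient of the node loss, in the
direction of the gradient of the objective. -/
noncomputable def sampleDeviation (f : Fin m → Fin M → Rn n → ℝ) (i : Fin m) (s : Fin M)
    (y : Rn n) : ℝ :=
  inner ℝ (∇ (objective f) y) (∇ (f i s) y - ∇ (nodeLoss f i) y)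

/-- The node gradient is the uniform average of the sample gradients; this centring is what the
Poisson equation requires. -/
theorem sum_sampleDeviation (hf : LossAssumptions B L f) (i : Fin m) (y : Rn n) :
    ∑ s, sampleDeviation f i s y = 0 := by
  simp only [sampleDeviation]
  rw [← inner_sum, Finset.sum_sub_distrib, hf.gradient_nodeLoss, Finset.sum_const,
    Finset.card_univ, Fintype.card_fin, ← Nat.cast_smul_eq_nsmul ℝ, smul_smul]
  rcases Nat.eq_zero_or_pos M with rfl | hM
  · simp
  have : (M : ℝ) ≠ 0 := by positivity
  rw [mul_one_div, div_self this, one_smul, sub_self, inner_zero_right]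

theorem norm_sample_sub_le (hf : LossAssumptions B L f) (hB : 0 ≤ B) (i : Fin m) (s : Fin M)
    (y : Rn n) : ‖∇ (f i s) y - ∇ (nodeLoss f i) y‖ ≤ 2 * B :=
  (norm_sub_le _ _).trans (by
    linarith [hf.gradient_bound i s y, hf.norm_gradient_nodeLoss_le hB i y])

theorem abs_sampleDeviation_le (hf : LossAssumptions B L f) (hB : 0 ≤ B) (i : Fin m) (s : Fin M)
    (y : Rn n) : |sampleDeviation f i s y| ≤ 2 * B ^ 2 := by
  refine (abs_real_inner_le_norm _ _).trans ?_
  calc _ ≤ B * (2 * B) := mul_le_mul (hf.norm_gradient_objective_le hB y)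
        (hf.norm_sample_sub_le hB i s y) (norm_nonneg _) hB
    _ = 2 * B ^ 2 := by ring

theorem sampleDeviation_lipschitz (hf : LossAssumptions B L f) (hB : 0 ≤ B) (hL : 0 ≤ L)
    (i : Fin m) (s : Fin M) (y z : Rn n) :
    |sampleDeviation f i s y - sampleDeviation f i s z| ≤ 4 * B * L * ‖y - z‖ := by
  have h1 : sampleDeviation f i s y - sampleDeviation f i s z
      = inner ℝ (∇ (objective f) y - ∇ (objective f) z) (∇ (f i s) y - ∇ (nodeLoss f i) y)
        + inner ℝ (∇ (objective f) z) ((∇ (f i s) y - ∇ (f i s) z)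
          - (∇ (nodeLoss f i) y - ∇ (nodeLoss f i) z)) := by
    simp only [sampleDeviation, inner_sub_left, inner_sub_right]
    ring
  have h2 : |inner ℝ (∇ (objective f) y - ∇ (objective f) z)
      (∇ (f i s) y - ∇ (nodeLoss f i) y)| ≤ (L * ‖y - z‖) * (2 * B) :=
    (abs_real_inner_le_norm _ _).trans <| mul_le_mul (hf.gradient_objective_lipschitz hL y z)
      (hf.norm_sample_sub_le hB i s y) (norm_nonneg _) (by positivity)
  have h3 : |inner ℝ (∇ (objective f) z) ((∇ (f i s) y - ∇ (f i s) z)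
      - (∇ (nodeLoss f i) y - ∇ (nodeLoss f i) z))| ≤ B * (2 * (L * ‖y - z‖)) :=
    (abs_real_inner_le_norm _ _).trans <| mul_le_mul (hf.norm_gradient_objective_le hB z)
      ((norm_sub_le _ _).trans (by
        linarith [hf.gradient_lipschitz i s y z, hf.gradient_nodeLoss_lipschitz hL i y z]))
      (norm_nonneg _) hB
  rw [h1]
  refine (abs_add_le _ _).trans ((add_le_add h2 h3).trans (le_of_eq (by ring)))

theorem continuous_gradient (hf : LossAssumptions B L f) (i : Fin m) (s : Fin M) :
    Continuous (∇ (f i s)) :=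
  continuous_of_lipschitz (hf.gradient_lipschitz i s)

theorem continuous_gradient_objective (hf : LossAssumptions B L f) (hL : 0 ≤ L) :
    Continuous (∇ (objective f)) :=
  continuous_of_lipschitz (hf.gradient_objective_lipschitz hL)

theorem continuous_sampleDeviation (hf : LossAssumptions B L f) (hL : 0 ≤ L) (i : Fin m)
    (s : Fin M) : Continuous (sampleDeviation f i s) :=
  (hf.continuous_gradient_objective hL).inner ((hf.continuous_gradient i s).sub
    (continuous_of_lipschitz (hf.gradient_nodeLoss_lipschitz hL i)))

/-- Replacing the local variables by a common point costs at most their distance from it. -/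
theorem sq_norm_gradient_objective_le (hf : LossAssumptions B L f) (hB : 0 ≤ B) (hL : 0 ≤ L)
    (hm : 0 < m) (s : Fin m → Fin M) (x : Fin m → Rn n) (y : Rn n) {c : ℝ}
    (hc : ∀ i, ‖x i - y‖ ≤ c) :
    ‖∇ (objective f) y‖ ^ 2 + (1 / (m : ℝ)) * ∑ i, sampleDeviation f i (s i) y - B * L * c
      ≤ (1 / (m : ℝ)) * ∑ i, inner ℝ (∇ (objective f) y) (∇ (f i (s i)) (x i)) := by
  have hm' : (0 : ℝ) < m := by exact_mod_cast hm
  have h1 : ∀ i, inner ℝ (∇ (objective f) y) (∇ (nodeLoss f i) y) + sampleDeviation f i (s i) y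
      - B * L * c ≤ inner ℝ (∇ (objective f) y) (∇ (f i (s i)) (x i)) := by
    intro i
    have h2 : inner ℝ (∇ (objective f) y) (∇ (nodeLoss f i) y) + sampleDeviation f i (s i) y
        = inner ℝ (∇ (objective f) y) (∇ (f i (s i)) (x i))
          - inner ℝ (∇ (objective f) y) (∇ (f i (s i)) (x i) - ∇ (f i (s i)) y) := by
      simp only [sampleDeviation, inner_sub_right]
      ring
    have h3 : |inner ℝ (∇ (objective f) y) (∇ (f i (s i)) (x i) - ∇ (f i (s i)) y)|
        ≤ B * (L * c) :=
      (abs_real_inner_le_norm _ _).trans <| mul_le_mul (hf.norm_gradient_objective_le hB y)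
        ((hf.gradient_lipschitz _ _ _ _).trans (mul_le_mul_of_nonneg_left (hc i) hL))
        (norm_nonneg _) hB
    linarith [(abs_le.mp h3).1]
  have h4 := mul_le_mul_of_nonneg_left (Finset.sum_le_sum fun i (_ : i ∈ Finset.univ) => h1 i)
    (by positivity : 0 ≤ 1 / (m : ℝ))
  rw [Finset.sum_sub_distrib, Finset.sum_add_distrib, Finset.sum_const, Finset.card_univ,
    Fintype.card_fin, nsmul_eq_mul, mul_sub, mul_add, ← inner_sum, ← real_inner_smul_right,
    ← hf.gradient_objective, real_inner_self_eq_norm_sq, ← mul_assoc (1 / (m : ℝ)) (m : ℝ),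
    one_div_mul_cancel hm'.ne', one_mul] at h4
  exact h4

end LossAssumptions

/-! ### The weighted sum of squared gradients and the conclusion -/

section Main

variable {Ω : Type*} {n m M : ℕ} {G : SimpleGraph (Fin m)} {W : Matrix (Fin m) (Fin m) ℝ} {B L : ℝ}
  {H : Matrix (Fin M) (Fin M) ℝ} {f : Fin m → Fin M → Rn n → ℝ} {γ δ : ℕ → ℝ} {x₀ : Rn n}
  {j : Fin m → ℕ → Ω → Fin M} {h : Fin m → ℕ → Ω → UnitSphere n} {y : ℕ → Ω → Rn n}

open LossAssumptions

/-- Measurability before the directions of time `k` are drawn serves twice: for independence from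
those directions and, by inclusion in `history`, for the Markov property. -/
theorem measurable_average_preHistory (hf : LossAssumptions B L f)
    (hy : ∀ k ω, y k ω =
      nodeAverage (zoDMGD W f γ δ x₀ (fun i l => j i l ω) (fun i l => h i l ω) k)) (k : ℕ) :
    Measurable[preHistory j h k] (y k) := by
  have h1 := measurable_zoDMGD_preHistory (j := j) (h := h) (W := W) (γ := γ) (δ := δ) (x₀ := x₀)
    (fun i s => (hf.differentiable i s).continuous) k
  have h2 : y k = fun ω => (1 / (m : ℝ)) • ∑ i,
      zoDMGD W f γ δ x₀ (fun i l => j i l ω) (fun i l => h i l ω) k i := funext (hy k)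
  rw [h2]
  exact (Finset.measurable_sum _ fun i _ => h1 i).const_smul (1 / (m : ℝ))

/-- The weighted sum of the second moments of the gradients at the averages. -/
theorem sum_integral_sq_gradient_le [mΩ : MeasurableSpace Ω] {P : Measure Ω}
    [IsProbabilityMeasure P] (hm : 0 < m) (hW : IsMixingMatrix G W)
    (hH : IsErgodicUniform H) (hf : LossAssumptions B L f) (hB : 0 ≤ B) (hL : 0 ≤ L) {D S Γ : ℝ}
    (hD : ∀ x, objective f x₀ - objective f x ≤ D) (hγ : Antitone γ) (hγ0 : ∀ k, 0 ≤ γ k)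
    (hδ : ∀ k, 0 < δ k) (hS : ∀ N, ∑ k ∈ Finset.range N, γ k * δ k ≤ S)
    (hΓ : ∀ N, ∑ k ∈ Finset.range N, γ k ^ 2 ≤ Γ) (hs : IsSampling P H j h)
    (hy : ∀ k ω, y k ω =
      nodeAverage (zoDMGD W f γ δ x₀ (fun i l => j i l ω) (fun i l => h i l ω) k)) (N : ℕ) :
    ∑ k ∈ Finset.range N, γ k * ∫ ω, ‖∇ (objective f) (y k ω)‖ ^ 2 ∂P
      ≤ D + L * (n * B) ^ 2 * Γ + B * n * L * S
        + B * L * (2 * m * (n * B) * (1 / (1 - secondModulus W)) * Γ)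
        + (M * ((2 * (M : ℝ) ^ 2 + 2) * (1 / (1 - secondModulus H)))) *
          (3 * (2 * B ^ 2) * γ 0 + 4 * B * L * (n * B) * Γ) := by
  have hm' : (0 : ℝ) < m := by exact_mod_cast hm
  have hjm := hs.measurable_sample
  have hhm := hs.measurable_direction
  set x : ℕ → Ω → Fin m → Rn n := fun k ω =>
    zoDMGD W f γ δ x₀ (fun i l => j i l ω) (fun i l => h i l ω) k with hx
  set U : ℕ → Ω → Rn n := fun k ω => ∇ (objective f) (y k ω) with hU
  set g : Fin m → ℕ → Ω → Rn n := fun i k ω => ∇ (f i (j i k ω)) (x k ω i) with hg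
  set T : Fin m → ℕ → Ω → ℝ := fun i k ω =>
    n * (inner ℝ (g i k ω) (h i k ω : Rn n) * inner ℝ (U k ω) (h i k ω : Rn n)) with hT
  set c := consensusBound (secondModulus W) (2 * m * (n * B)) γ with hc
  have hpre : ∀ k, preHistory j h k ≤ mΩ := preHistory_le hjm hhm
  have hym : ∀ k, Measurable[preHistory j h k] (y k) := measurable_average_preHistory hf hy
  have hym' : ∀ k, Measurable (y k) := fun k => (hym k).mono (hpre k) le_rfl
  have hxm : ∀ k i, Measurable[preHistory j h k] fun ω => x k ω i := fun k i =>
    measurable_zoDMGD_preHistory (fun i s => (hf.differentiable i s).continuous) k i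
  have hUm : ∀ k, Measurable[preHistory j h k] (U k) := fun k =>
    (hf.continuous_gradient_objective hL).measurable.comp (hym k)
  have hgm : ∀ i k, Measurable[preHistory j h k] (g i k) := fun i k =>
    @measurable_apply_index Ω (preHistory j h k) M _ _ _ _ (fun s => ∇ (f i s))
      (fun s => (hf.continuous_gradient i s).measurable) (j i k)
      (measurable_sample_preHistory le_rfl i) (fun ω => x k ω i) (hxm k i)
  have hUm' : ∀ k, Measurable (U k) := fun k => (hUm k).mono (hpre k) le_rfl
  have hgm' : ∀ i k, Measurable (g i k) := fun i k => (hgm i k).mono (hpre k) le_rfl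
  have hUB : ∀ k ω, ‖U k ω‖ ≤ B := fun k ω => hf.norm_gradient_objective_le hB _
  have hgB : ∀ i k ω, ‖g i k ω‖ ≤ B := fun i k ω => hf.gradient_bound _ _ _
  have hhvm : ∀ i k, Measurable fun ω => (h i k ω : Rn n) := fun i k =>
    measurable_subtype_coe.comp (hhm i k)
  have hTm : ∀ i k, Measurable (T i k) := fun i k =>
    (((hgm' i k).inner (hhvm i k)).mul ((hUm' k).inner (hhvm i k))).const_mul _
  have hTb : ∀ i k ω, |T i k ω| ≤ n * (B * B) := fun i k ω => by
    have hh : ‖(h i k ω : Rn n)‖ = 1 := norm_eq_of_mem_sphere _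
    have h1 := abs_real_inner_le_norm (g i k ω) (h i k ω : Rn n)
    have h2 := abs_real_inner_le_norm (U k ω) (h i k ω : Rn n)
    rw [hh, mul_one] at h1 h2
    simp only [hT, abs_mul, Nat.abs_cast]
    exact mul_le_mul_of_nonneg_left (mul_le_mul (h1.trans (hgB i k ω)) (h2.trans (hUB k ω))
      (abs_nonneg _) hB) (Nat.cast_nonneg n)
  have hTi : ∀ i k, Integrable (T i k) P := fun i k => integrable_of_abs_le (hTm i k) (hTb i k)
  have hUgm : ∀ i k, Integrable (fun ω => inner ℝ (U k ω) (g i k ω)) P := fun i k =>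
    integrable_of_abs_le ((hUm' k).inner (hgm' i k)) (K := B * B) fun ω =>
      (abs_real_inner_le_norm _ _).trans
        (mul_le_mul (hUB k ω) (hgB i k ω) (norm_nonneg _) hB)
  -- The sample `j i k` already belongs to `preHistory j h k`, so the gradient `g i k` is fixed when
  -- the direction is averaged out.
  have hTU : ∀ i k, ∫ ω, T i k ω ∂P = ∫ ω, inner ℝ (U k ω) (g i k ω) ∂P := fun i k =>
    integral_inner_direction (hhm i k) (hs.uniform i k) (hpre k) (hs.indep i k) (hgm i k) (hUm k)
      (hgB i k) (hUB k)
  -- the descent inequality in expectation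
  have hdescent : ∑ k ∈ Finset.range N, γ k * ((1 / (m : ℝ)) * ∑ i, ∫ ω, T i k ω ∂P)
      ≤ D + L * (n * B) ^ 2 * Γ + B * n * L * S := by
    have h1 : ∀ ω, ∑ k ∈ Finset.range N, γ k * ((1 / (m : ℝ)) * ∑ i, T i k ω)
        ≤ D + L * (n * B) ^ 2 * Γ + B * n * L * S := by
      intro ω
      have h2 := sum_descent_le hW hf hB hL hγ0 hδ hD hm (fun i l => j i l ω)
        (fun i l => h i l ω) N
      simp only [← hy] at h2
      refine h2.trans (add_le_add (add_le_add le_rfl ?_) ?_)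
      · exact mul_le_mul_of_nonneg_left (hΓ N) (by positivity)
      · exact mul_le_mul_of_nonneg_left (hS N) (by positivity)
    have hi : ∀ k, Integrable (fun ω => γ k * ((1 / (m : ℝ)) * ∑ i, T i k ω)) P := fun k =>
      ((integrable_finsetSum _ fun i _ => hTi i k).const_mul _).const_mul _
    have h3 := integral_mono (μ := P) (integrable_finsetSum (Finset.range N) fun k _ => hi k)
      (integrable_const _) h1
    rw [integral_finsetSum _ fun k _ => hi k, integral_const, probReal_univ, one_smul] at h3
    refine le_trans (le_of_eq (Finset.sum_congr rfl fun k _ => ?_)) h3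
    rw [integral_const_mul, integral_const_mul, integral_finsetSum _ fun i _ => hTi i k]
  -- the comparison with the gradient at the average
  have hφi : ∀ i k, Integrable (fun ω => sampleDeviation f i (j i k ω) (y k ω)) P := fun i k =>
    integrable_of_abs_le (measurable_apply_index
      (fun s => (hf.continuous_sampleDeviation hL i s).measurable) (hjm i k) (hym' k))
      fun ω => hf.abs_sampleDeviation_le hB _ _ _
  have hU2 : ∀ k, Integrable (fun ω => ‖U k ω‖ ^ 2) P := fun k =>
    integrable_of_abs_le ((hUm' k).norm.pow_const 2) (K := B ^ 2) fun ω => by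
      rw [abs_of_nonneg (by positivity)]
      exact pow_le_pow_left₀ (norm_nonneg _) (hUB k ω) 2
  have hcomp : ∀ k, ∫ ω, ‖U k ω‖ ^ 2 ∂P
      + (1 / (m : ℝ)) * ∑ i, ∫ ω, sampleDeviation f i (j i k ω) (y k ω) ∂P - B * L * c k
      ≤ (1 / (m : ℝ)) * ∑ i, ∫ ω, T i k ω ∂P := by
    intro k
    have h1 : ∀ ω, ‖U k ω‖ ^ 2 + (1 / (m : ℝ)) * ∑ i, sampleDeviation f i (j i k ω) (y k ω)
        - B * L * c k ≤ (1 / (m : ℝ)) * ∑ i, inner ℝ (U k ω) (g i k ω) := fun ω =>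
      hf.sq_norm_gradient_objective_le hB hL hm (fun i => j i k ω) (x k ω) (y k ω) fun i => by
        rw [hy]
        exact (norm_sub_nodeAverage_le _ i).trans (dispersion_zoDMGD_le hW hf hB hγ0 hδ _ _ k)
    have i1 : Integrable (fun ω => (1 / (m : ℝ)) * ∑ i, sampleDeviation f i (j i k ω) (y k ω)) P :=
      (integrable_finsetSum _ fun i _ => hφi i k).const_mul _
    have i2 : Integrable (fun ω => (1 / (m : ℝ)) * ∑ i, inner ℝ (U k ω) (g i k ω)) P :=
      (integrable_finsetSum _ fun i _ => hUgm i k).const_mul _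
    have h3 := integral_mono (μ := P) (((hU2 k).add i1).sub (integrable_const _)) i2 h1
    simp only [hTU]
    rw [integral_const_mul, integral_finsetSum _ fun i _ => hUgm i k] at h3
    refine le_trans (le_of_eq ?_) h3
    have h4 : ∫ ω, ((fun ω => ‖U k ω‖ ^ 2) + fun ω => (1 / (m : ℝ)) *
        ∑ i, sampleDeviation f i (j i k ω) (y k ω)) ω ∂P
        = ∫ ω, ‖U k ω‖ ^ 2 ∂P
          + (1 / (m : ℝ)) * ∑ i, ∫ ω, sampleDeviation f i (j i k ω) (y k ω) ∂P := by
      rw [integral_add' (hU2 k) i1, integral_const_mul, integral_finsetSum _ fun i _ => hφi i k]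
    rw [← h4]
    rw [integral_sub' ((hU2 k).add i1) (integrable_const _), integral_const, probReal_univ,
      one_smul]
  -- the deviations of the samples
  set R := (M * ((2 * (M : ℝ) ^ 2 + 2) * (1 / (1 - secondModulus H)))) *
          (3 * (2 * B ^ 2) * γ 0 + 4 * B * L * (n * B) * Γ) with hR
  have hmarkov : ∀ i, -R ≤ ∑ k ∈ Finset.range N,
      γ k * ∫ ω, sampleDeviation f i (j i k ω) (y k ω) ∂P := by
    intro i
    have h1 := (hs.markov i).abs_sum_integral_le (hjm i) (fun k => history_le hjm hhm k) hH
      (fun s => (hf.continuous_sampleDeviation hL i s).measurable) (hf.sum_sampleDeviation i)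
      (hf.abs_sampleDeviation_le hB i) (hf.sampleDeviation_lipschitz hB hL i) (by positivity)
      (fun k => (hym k).mono (preHistory_le_history k) le_rfl) hγ hγ0 (c := n * B)
      (fun k ω => by
        rw [hy, hy]
        exact norm_nodeAverage_zoDMGD_succ_sub_le hW hf hB hγ0 hδ _ _ k) N
    refine (neg_le_neg (h1.trans ?_)).trans (neg_abs_le _)
    have := hH.secondModulus_lt_one
    refine mul_le_mul_of_nonneg_left (add_le_add le_rfl ?_) (mul_nonneg (by positivity)
      (mul_nonneg (by positivity) (one_div_nonneg.mpr (by linarith))))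
    exact mul_le_mul_of_nonneg_left (hΓ N) (by positivity)
  have hcons : ∑ k ∈ Finset.range N, γ k * c k
      ≤ 2 * m * (n * B) * (1 / (1 - secondModulus W)) * Γ := by
    have h1 := hW.secondModulus_lt_one
    refine (sum_mul_contraction_le hγ hγ0 h1
      (consensusBound_nonneg (secondModulus_nonneg W) (by positivity) hγ0) rfl
      (fun k => rfl) N).trans ?_
    exact mul_le_mul_of_nonneg_left (hΓ N) (mul_nonneg (by positivity)
      (one_div_nonneg.mpr (by linarith)))
  have hfinal : ∑ k ∈ Finset.range N, γ k * (∫ ω, ‖U k ω‖ ^ 2 ∂P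
      + (1 / (m : ℝ)) * ∑ i, ∫ ω, sampleDeviation f i (j i k ω) (y k ω) ∂P - B * L * c k)
      ≤ D + L * (n * B) ^ 2 * Γ + B * n * L * S :=
    (Finset.sum_le_sum fun k _ => mul_le_mul_of_nonneg_left (hcomp k) (hγ0 k)).trans hdescent
  have hsplit : ∑ k ∈ Finset.range N, γ k * (∫ ω, ‖U k ω‖ ^ 2 ∂P
      + (1 / (m : ℝ)) * ∑ i, ∫ ω, sampleDeviation f i (j i k ω) (y k ω) ∂P - B * L * c k)
      = ∑ k ∈ Finset.range N, γ k * ∫ ω, ‖U k ω‖ ^ 2 ∂P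
        + (1 / (m : ℝ)) * ∑ i, ∑ k ∈ Finset.range N,
          γ k * ∫ ω, sampleDeviation f i (j i k ω) (y k ω) ∂P
        - B * L * ∑ k ∈ Finset.range N, γ k * c k := by
    rw [Finset.sum_comm, Finset.mul_sum, Finset.mul_sum, ← Finset.sum_add_distrib,
      ← Finset.sum_sub_distrib]
    refine Finset.sum_congr rfl fun k _ => ?_
    rw [← Finset.mul_sum]
    ring
  have hdev : -R ≤ (1 / (m : ℝ)) * ∑ i, ∑ k ∈ Finset.range N,
          γ k * ∫ ω, sampleDeviation f i (j i k ω) (y k ω) ∂P := by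
    have h1 := mul_le_mul_of_nonneg_left
      (Finset.sum_le_sum fun i (_ : i ∈ Finset.univ) => hmarkov i)
      (by positivity : 0 ≤ 1 / (m : ℝ))
    rwa [Finset.sum_const, Finset.card_univ, Fintype.card_fin, nsmul_eq_mul, ← mul_assoc,
      one_div_mul_cancel hm'.ne', one_mul] at h1
  have hBL := mul_le_mul_of_nonneg_left hcons (mul_nonneg hB hL)
  rw [hsplit] at hfinal
  linarith

end Main

/-- The bound of the weighted sum, in terms of the factor of the convergence rate. -/
theorem weighted_bound_le {n m M : ℕ} {B L D S Γ a b a' T : ℝ} (hn : 1 ≤ n) (hB : 0 ≤ B)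
    (hL : 0 ≤ L) (hD : 0 ≤ D) (hS : 0 ≤ S) (hΓ : 0 ≤ Γ) (hb : 1 ≤ b) (ha : 1 ≤ a)
    (haa : a' ≤ a) (hT : T = a * b + (n : ℝ) ^ (3 / 2 : ℝ)) :
    D + L * (n * B) ^ 2 * Γ + B * n * L * S + B * L * (2 * m * (n * B) * b * Γ)
        + (M * ((2 * (M : ℝ) ^ 2 + 2) * a')) * (3 * (2 * B ^ 2) * 1 + 4 * B * L * (n * B) * Γ)
      ≤ (D + L * B ^ 2 * Γ + B * L * S + B * L * (2 * m * B * Γ)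
        + (M * (2 * (M : ℝ) ^ 2 + 2)) * (6 * B ^ 2 + 4 * B * L * B * Γ)) * T ^ 2 := by
  have hn1 : (1 : ℝ) ≤ n := by exact_mod_cast hn
  -- Since `a, b ≥ 1`, `T` dominates each of `n`, `a` and `b`; every term of the bound is at most
  -- quadratic in these, hence bounded by `T ^ 2`.
  have hn32 : (n : ℝ) ≤ (n : ℝ) ^ (3 / 2 : ℝ) := by
    conv_lhs => rw [← Real.rpow_one (n : ℝ)]
    exact Real.rpow_le_rpow_of_exponent_le hn1 (by norm_num)
  have hab : a ≤ a * b := le_mul_of_one_le_right (by linarith) hb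
  have hab' : b ≤ a * b := le_mul_of_one_le_left (by linarith) ha
  have hTn : (n : ℝ) ≤ T := by rw [hT]; linarith
  have hTa : a ≤ T := by rw [hT]; linarith
  have hTb : b ≤ T := by rw [hT]; linarith
  have hT1 : 1 ≤ T := hn1.trans hTn
  have hT0 : 0 ≤ T := by linarith
  have h1 : 1 ≤ T ^ 2 := one_le_pow₀ hT1
  have h2 : (n : ℝ) ^ 2 ≤ T ^ 2 := pow_le_pow_left₀ (by positivity) hTn 2
  have h3 : (n : ℝ) ≤ T ^ 2 := hTn.trans (by nlinarith)
  have h4 : n * b ≤ T ^ 2 := by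
    rw [pow_two]; exact mul_le_mul hTn hTb (by linarith) hT0
  have h5 : a' ≤ T ^ 2 := (haa.trans hTa).trans (by nlinarith)
  have h6 : a' * n ≤ T ^ 2 := by
    rw [pow_two]; exact mul_le_mul (haa.trans hTa) hTn (by linarith) hT0
  have e1 := mul_le_mul_of_nonneg_left h1 hD
  have e2 := mul_le_mul_of_nonneg_left h2 (by positivity : 0 ≤ L * B ^ 2 * Γ)
  have e3 := mul_le_mul_of_nonneg_left h3 (by positivity : 0 ≤ B * L * S)
  have e4 := mul_le_mul_of_nonneg_left h4 (by positivity : 0 ≤ B * L * (2 * m * B * Γ))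
  have e5 := mul_le_mul_of_nonneg_left h5
    (by positivity : 0 ≤ (M * (2 * (M : ℝ) ^ 2 + 2)) * (6 * B ^ 2))
  have e6 := mul_le_mul_of_nonneg_left h6
    (by positivity : 0 ≤ (M * (2 * (M : ℝ) ^ 2 + 2)) * (4 * B * L * B * Γ))
  nlinarith [e1, e2, e3, e4, e5, e6]

theorem IsErgodicUniform.one_le_one_div_log {M : ℕ} {H : Matrix (Fin M) (Fin M) ℝ}
    (hH : IsErgodicUniform H) : 1 ≤ 1 / Real.log (1 / lambdaH H) := by
  have h1 := hH.secondModulus_lt_one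
  have h0 := secondModulus_nonneg H
  exact le_trans (by rw [le_div_iff₀ (by linarith)]; linarith) hH.one_div_gap_le

theorem theorem2 (m M : ℕ) (θ : ℝ) (hθ : 1 / 2 < θ) (hθ' : θ < 1) (B L D S : ℝ) :
    -- the constant depends on `m`, `M`, `θ`, `B`, `L`, `D`, `S` only
    ∃ C : ℝ,
      ∀ (n : ℕ) (G : SimpleGraph (Fin m)) (_ : G.Connected)
        (W : Matrix (Fin m) (Fin m) ℝ) (_ : IsMixingMatrix G W)
        (H : Matrix (Fin M) (Fin M) ℝ) (_ : IsErgodicUniform H)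
        (f : Fin m → Fin M → Rn n → ℝ) (_ : LossAssumptions B L f)
        (x₀ : Rn n) (_ : ∀ x, objective f x₀ - objective f x ≤ D)
        (γ δ : ℕ → ℝ) (_ : ∀ k, γ k = 1 / ((k : ℝ) + 1) ^ θ) (_ : ∀ k, 0 < δ k)
        (_ : Summable fun k => γ k * δ k) (_ : ∑' k, γ k * δ k ≤ S)
        (Ω : Type*) [MeasurableSpace Ω] (P : Measure Ω) [IsProbabilityMeasure P]
        (j : Fin m → ℕ → Ω → Fin M) (h : Fin m → ℕ → Ω → UnitSphere n)
        (_ : IsSampling P H j h)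
        (xbar : ℕ → Ω → Rn n)
        (_ : ∀ k ω, xbar k ω =
          nodeAverage (zoDMGD W f γ δ x₀ (fun i l => j i l ω) (fun i l => h i l ω) k)),
        (∀ k, Integrable (fun ω => ‖∇ (objective f) (xbar k ω)‖) P) ∧
        Tendsto (fun k => ∫ ω, ‖∇ (objective f) (xbar k ω)‖ ∂P) atTop (𝓝 0) ∧
        ∀ (k : ℕ) (hk : 1 ≤ k),
          (Finset.Icc 1 k).inf' (Finset.nonempty_Icc.mpr hk)
              (fun i => ∫ ω, ‖∇ (objective f) (xbar i ω)‖ ∂P)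
            ≤ C * ((1 / Real.log (1 / lambdaH H)) * (1 / (1 - secondModulus W))
                    + (n : ℝ) ^ (3 / 2 : ℝ)) / (k : ℝ) ^ ((1 - θ) / 2) := by
  set Γ : ℝ := ∑' k : ℕ, (1 / ((k : ℝ) + 1) ^ θ) ^ 2 with hΓdef
  set C₀ : ℝ := D + L * B ^ 2 * Γ + B * L * S + B * L * (2 * m * B * Γ)
        + (M * (2 * (M : ℝ) ^ 2 + 2)) * (6 * B ^ 2 + 4 * B * L * B * Γ) with hC₀
  -- `C₀` is the coefficient of `T ^ 2` in `weighted_bound_le`, the root comes from passing to first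
  -- moments, and `2` from `inf'_le_of_weighted_sum`. The sum `Γ` depends on `θ` alone.
  refine ⟨2 * √C₀, ?_⟩
  intro n G hG W hW H hH f hf x₀ hD γ δ hγ hδ hsum hS Ω _ P _ j h hs y hy
  have hm : 0 < m := by
    obtain ⟨i⟩ := hG.nonempty
    exact i.pos
  obtain ⟨ω₀⟩ : Nonempty Ω := nonempty_of_isProbabilityMeasure P
  -- The directions provide a unit vector, which excludes `n = 0`; the same vector, compared with
  -- `0`, yields `0 ≤ L` below.
  have hn : 1 ≤ n := by
    rcases Nat.eq_zero_or_pos n with rfl | hn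
    · have h1 : ‖(h ⟨0, hm⟩ 0 ω₀ : Rn 0)‖ = 1 := norm_eq_of_mem_sphere _
      rw [Subsingleton.elim (h ⟨0, hm⟩ 0 ω₀ : Rn 0) 0, norm_zero] at h1
      exact absurd h1 zero_ne_one
    · exact hn
  have hB : 0 ≤ B := (norm_nonneg _).trans (hf.gradient_bound ⟨0, hm⟩ (j ⟨0, hm⟩ 0 ω₀) 0)
  have hL : 0 ≤ L := by
    have h1 := (norm_nonneg _).trans (hf.gradient_lipschitz ⟨0, hm⟩ (j ⟨0, hm⟩ 0 ω₀)
      (h ⟨0, hm⟩ 0 ω₀ : Rn n) 0)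
    rwa [sub_zero, norm_eq_of_mem_sphere, mul_one] at h1
  have hD0 : 0 ≤ D := by simpa using hD x₀
  have hγ0 := stepSize_nonneg hγ
  have hγδ0 : ∀ k, 0 ≤ γ k * δ k := fun k => mul_nonneg (hγ0 k) (hδ k).le
  have hS0 : 0 ≤ S := (tsum_nonneg hγδ0).trans hS
  have hγa := stepSize_antitone (by linarith) hγ
  have hγ2 : Summable fun k => γ k ^ 2 := summable_stepSize_pow hγ (d := 2) (by push_cast; linarith)
  have hΓ : ∀ N, ∑ k ∈ Finset.range N, γ k ^ 2 ≤ Γ := fun N => by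
    have h1 : Γ = ∑' k, γ k ^ 2 := tsum_congr fun k => by rw [hγ]
    rw [h1]
    exact hγ2.sum_le_tsum _ fun k _ => sq_nonneg _
  have hΓ0 : 0 ≤ Γ := by simpa using hΓ 0
  have hγ1 : γ 0 = 1 := by rw [hγ]; simp
  have hW1 := hW.secondModulus_lt_one
  have hW0 := secondModulus_nonneg W
  have hb : 1 ≤ 1 / (1 - secondModulus W) := by
    rw [le_div_iff₀ (by linarith)]; linarith
  set T := (1 / Real.log (1 / lambdaH H)) * (1 / (1 - secondModulus W))
    + (n : ℝ) ^ (3 / 2 : ℝ) with hT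
  have hT0 : 0 ≤ T := add_nonneg (mul_nonneg (zero_le_one.trans hH.one_le_one_div_log)
    (zero_le_one.trans hb)) (by positivity)
  have hC₀0 : 0 ≤ C₀ := by positivity
  have hym : ∀ k, Measurable (y k) := fun k => (measurable_average_preHistory hf hy k).mono
    (preHistory_le hs.measurable_sample hs.measurable_direction k) le_rfl
  have hUm : ∀ k, Measurable fun ω => ‖∇ (objective f) (y k ω)‖ := fun k =>
    ((hf.continuous_gradient_objective hL).measurable.comp (hym k)).norm
  have hUb : ∀ k ω, |‖∇ (objective f) (y k ω)‖| ≤ B := fun k ω => by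
    rw [abs_norm]; exact hf.norm_gradient_objective_le hB _
  have hint : ∀ k, Integrable (fun ω => ‖∇ (objective f) (y k ω)‖) P := fun k =>
    integrable_of_abs_le (hUm k) (hUb k)
  set a : ℕ → ℝ := fun k => ∫ ω, ‖∇ (objective f) (y k ω)‖ ∂P with ha
  have ha0 : ∀ k, 0 ≤ a k := fun k => integral_nonneg fun ω => norm_nonneg _
  have hmain : ∀ N, ∑ k ∈ Finset.range N, γ k * a k ^ 2 ≤ (√C₀ * T) ^ 2 := by
    intro N
    have h1 := sum_integral_sq_gradient_le hm hW hH hf hB hL hD hγa hγ0 hδ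
      (fun N => (hsum.sum_le_tsum _ fun k _ => hγδ0 k).trans hS) hΓ hs hy N
    rw [hγ1] at h1
    have h2 := weighted_bound_le (m := m) (M := M) hn hB hL hD0 hS0 hΓ0 hb hH.one_le_one_div_log
      hH.one_div_gap_le hT
    rw [mul_pow, Real.sq_sqrt hC₀0]
    refine (Finset.sum_le_sum fun k _ => ?_).trans (h1.trans h2)
    exact mul_le_mul_of_nonneg_left (sq_integral_le_integral_sq (hUm k) (hUb k)) (hγ0 k)
  refine ⟨hint, ?_, fun k hk => ?_⟩
  · refine tendsto_zero_of_weighted_summable hγ0 (not_summable_stepSize hθ'.le hγ)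
      (summable_stepSize_pow hγ (d := 3) (by push_cast; linarith)) ha0 hmain (c := L * (n * B))
      (fun k => ?_) (by positivity)
    simp only [ha]
    rw [← integral_sub (hint _) (hint _)]
    refine abs_integral_le_of_abs_le fun ω => ?_
    refine (abs_norm_sub_norm_le _ _).trans ((hf.gradient_objective_lipschitz hL _ _).trans ?_)
    rw [mul_assoc, hy, hy]
    exact mul_le_mul_of_nonneg_left
      (norm_nodeAverage_zoDMGD_succ_sub_le hW hf hB hγ0 hδ _ _ k) hL
  · have h1 := inf'_le_of_weighted_sum (by linarith) hθ'.le hγ ha0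
      (mul_nonneg (Real.sqrt_nonneg _) hT0) hmain hk
    rwa [← mul_assoc] at h1
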